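/- **Notation.** For integers $0\le m\le q$, $0\le n\le p$, real $a_i,b_i$ and positive $A_i,B_i$, the Fox H-function is, for $x>0$, $$H^{m,n}_{p,q}\Big(x\,\Big|\begin{matrix}(a_i,A_i)_{1:p}\\(b_i,B_i)_{1:q}\end{matrix}\Big)=\frac1{2\pi j}\int_{\mathcal L}\Theta(s)\,x^{-s}\,ds,\qquad \Theta(s)=\frac{\prod_{i\le m}\Gamma(b_i+B_is)\prod_{i\le n}\Gamma(1-a_i-A_is)}{\prod_{i>n}\Gamma(a_i+A_is)\prod_{i>m}\Gamma(1-b_i-B_is)},$$ where $\mathcal L$ is a vertical line that separates the poles of the factors $\Gamma(b_i+B_is)$, $i\le m$, from those of the factors $\Gamma(1-a_i-A_is)$, $i\le n$, and along which the integral converges absolutely. **Setting.** Let the SNR $\gamma_{id}$ be a positive random variable with probability density $$f(x)=\sum_{\ell=1}^L\psi_\ell\,H^{m,n}_{p,q}\Big(\phi_\ell x\,\Big|\begin{matrix}(a^{(\ell)}_i,A^{(\ell)}_i)_{1:p}\\(b^{(\ell)}_i,B^{(\ell)}_i)_{1:q}\end{matrix}\Big),\qquad x>0,$$ with $\psi_\ell,\phi_\ell>0$,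 and let $\Theta_\ell$ be the kernel of the $\ell$-th term. For $\omega,\varrho,\tau>0$ let $\gamma_\varkappa=\omega/(\varrho+\tau/\gamma_{id})$ be the SINR of the impaired link, $F_{\gamma_\varkappa}$ its distribution function, and $$\mathcal C=\frac1{\log 2}\int_0^{\omega/\varrho}\log(1+\gamma)\,\frac{\partial F_{\gamma_\varkappa}(\gamma)}{\partial\gamma}\,d\gamma$$ its ergodic capacity under the optimal rate adaptation policy. Put $\Psi^{(\ell)}=(a^{(\ell)}_i+A^{(\ell)}_i,A^{(\ell)}_i)_{1:p}$ and $\Upsilon^{(\ell)}=(b^{(\ell)}_i+B^{(\ell)}_i,B^{(\ell)}_i)_{1:q}$. For each $\ell$ let $\mathcal L_v^{(\ell)}=\{\operatorname{Re}v=c_\ell\}$ and $\mathcal L_w^{(\ell)}=\{\operatorname{Re}w=d_\ell\}$ be any vertical lines such that $\mathcal L_v^{(\ell)}$ is a contour, in the above sense, for the H-function $H^{m+1,n}_{p+1,q+1}$ with upper parameters $\Psi^{(\ell)},(1,1)$ and lower parameters $(0,1),\Upsilon^{(\ell)}$ (the one in $F_{\gamma_\varkappa}$), and the pair separates the poles of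 the numerator Gamma functions of the bivariate H-function below; explicitly, $\Theta_\ell(v+1)/v$ is absolutely integrable along $\mathcal L_v^{(\ell)}$, the line $\operatorname{Re}s=c_\ell+1$ separates the poles of $\Theta_\ell$ as above, $c_\ell>0$ and $-1<d_\ell<-c_\ell$. **Claim.** $F_{\gamma_\varkappa}$ is differentiable on $(0,\omega/\varrho)$, the integral defining $\mathcal C$ converges absolutely, the bivariate Mellin–Barnes integrals below converge absolutely, and $$\mathcal C=\frac1{\log2}\sum_{\ell=1}^L\frac{\psi_\ell}{\phi_\ell}\,H^{0,1:m+1,n:1,1}_{1,0:p,q+1:1,2}\left(\frac{\phi_\ell\tau}{\varrho},\frac{\omega}{\varrho}\,\middle|\begin{matrix}(1;1,1)\\-\end{matrix}\middle|\begin{matrix}\Psi^{(\ell)}\\(0,1),\Upsilon^{(\ell)}\end{matrix}\middle|\begin{matrix}(1,1)\\(1,1);(0,1)\end{matrix}\right),$$ where the $\ell$-th bivariate Fox H-function is $$\Big(\frac1{2\pi j}\Big)^2\int_{\mathcal L_v^{(\ell)}}\int_{\mathcal L_w^{(\ell)}}\Gamma(-v-w)\,\Gamma(v)\,\Theta_\ell(v+1)\,\frac{\Gamma(1+w)\Gamma(-w)}{\Gamma(1-w)}\Big(\frac{\phi_\ell\tau}{\varrho}\Big)^{-v}\Big(\frac{\omega}{\varrho}\Big)^{-w}\,dw\,dv.$$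 -/

import Mathlib

open MeasureTheory

noncomputable section

/-- The data of a Mellin–Barnes kernel `H^{m,n}_{p,q}`: the orders `m`, `n` and the parameter pairs
`(a i, A i)`, `i : Fin p`, and `(b i, B i)`, `i : Fin q`. -/
structure FoxParams (p q : ℕ) where
  /-- the first `m` lower pairs give numerator Gamma factors -/
  m : ℕ
  /-- the first `n` upper pairs give numerator Gamma factors -/
  n : ℕ
  a : Fin p → ℝ
  A : Fin p → ℝ
  b : Fin q → ℝ
  B : Fin q → ℝ

namespace FoxParams

variable {p q : ℕ}

/-- The kernel
`∏_{i ≤ m} Γ(b_i + B_i s) ∏_{i ≤ n} Γ(1 - a_i - A_i s) /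
  (∏_{i > n} Γ(a_i + A_i s) ∏_{i > m} Γ(1 - b_i - B_i s))`.
(`Complex.Gamma` is `0` at its poles, so that division by it is multiplication by the entire
function `1/Γ`.) -/
def kernel (P : FoxParams p q) (s : ℂ) : ℂ :=
  ((∏ i : Fin q with i.val < P.m, Complex.Gamma (P.b i + P.B i * s)) *
      ∏ i : Fin p with i.val < P.n, Complex.Gamma (1 - P.a i - P.A i * s)) /
    ((∏ i : Fin p with P.n ≤ i.val, Complex.Gamma (P.a i + P.A i * s)) *
      ∏ i : Fin q with P.m ≤ i.val, Complex.Gamma (1 - P.b i - P.B i * s))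

/-- The vertical line `Re s = σ` separates the poles of the factors `Γ(b_i + B_i s)`, `i ≤ m`
(on its left) from those of the factors `Γ(1 - a_i - A_i s)`, `i ≤ n` (on its right);
the `A_i` and `B_i` are positive. -/
def Separates (P : FoxParams p q) (σ : ℝ) : Prop :=
  (∀ i : Fin q, i.val < P.m → 0 < P.b i + P.B i * σ) ∧
    ∀ i : Fin p, i.val < P.n → 0 < 1 - P.a i - P.A i * σ

/-- The line `Re s = σ` is a contour for the univariate H-function on `(0, ∞)`: it separates the
poles and the Mellin–Barnes integral converges absolutely along it
(`|x ^ (-s)| = x ^ (-σ)` is constant on the line). -/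
def IsContour (P : FoxParams p q) (σ : ℝ) : Prop :=
  P.Separates σ ∧ Integrable fun y : ℝ => P.kernel (σ + y * Complex.I)

/-- The univariate Fox H-function `(2πj)⁻¹ ∫_{Re s = σ} kernel(s) x^{-s} ds`
(with `s = σ + j y`, `ds = j dy`). -/
def foxH (P : FoxParams p q) (σ x : ℝ) : ℂ :=
  1 / (2 * Real.pi) *
    ∫ y : ℝ, P.kernel (σ + y * Complex.I) * (x : ℂ) ^ (-(σ + y * Complex.I))

/-- The parameters `Ψ` above and `(0,1), Υ` below, of order `m + 1`, `n`, where
`Ψ = (a_i + A_i, A_i)_i` and `Υ = (b_i + B_i, B_i)_i`. -/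
def shift (P : FoxParams p q) : FoxParams p (q + 1) where
  m := P.m + 1
  n := P.n
  a := fun i => P.a i + P.A i
  A := P.A
  b := Fin.cons 0 fun i => P.b i + P.B i
  B := Fin.cons 1 P.B

/-- The parameters `Ψ, (1,1)` above and `(0,1), Υ` below, of order `m + 1`, `n`: those of the
H-function in the complementary distribution function of a density `H^{m,n}_{p,q}`. -/
def ccdf (P : FoxParams p q) : FoxParams (p + 1) (q + 1) where
  m := P.m + 1
  n := P.n
  a := Fin.snoc (fun i => P.a i + P.A i) 1
  A := Fin.snoc P.A 1
  b := Fin.cons 0 fun i => P.b i + P.B i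
  B := Fin.cons 1 P.B

end FoxParams

/-- The data of the bivariate H-function `H^{m₁,n₁ : m₂,n₂ : m₃,n₃}_{p₁,q₁ : p₂,q₂ : p₃,q₃}`:
the triples `(a i; α i, A i)` and `(b i; β i, B i)` that couple the two variables, and the
parameters of the two univariate kernels. -/
structure BiFoxParams (p₁ q₁ p₂ q₂ p₃ q₃ : ℕ) where
  m : ℕ
  n : ℕ
  a : Fin p₁ → ℝ
  α : Fin p₁ → ℝ
  A : Fin p₁ → ℝ
  b : Fin q₁ → ℝ
  β : Fin q₁ → ℝ
  B : Fin q₁ → ℝ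
  P : FoxParams p₂ q₂
  Q : FoxParams p₃ q₃

namespace BiFoxParams

variable {p₁ q₁ p₂ q₂ p₃ q₃ : ℕ}

/-- The kernel of the bivariate H-function: the coupled Gamma factors in `(v, w)` times one
univariate kernel in `v` and one in `w`. -/
def kernel (R : BiFoxParams p₁ q₁ p₂ q₂ p₃ q₃) (v w : ℂ) : ℂ :=
  ((∏ i : Fin q₁ with i.val < R.m, Complex.Gamma (R.b i + R.β i * v + R.B i * w)) *
      ∏ i : Fin p₁ with i.val < R.n, Complex.Gamma (1 - R.a i - R.α i * v - R.A i * w)) /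
    ((∏ i : Fin p₁ with R.n ≤ i.val, Complex.Gamma (R.a i + R.α i * v + R.A i * w)) *
      ∏ i : Fin q₁ with R.m ≤ i.val, Complex.Gamma (1 - R.b i - R.β i * v - R.B i * w)) *
    R.P.kernel v * R.Q.kernel w

/-- The pair of lines `Re v = c`, `Re w = d` separates the two families of poles of the
numerator Gamma factors. -/
def Separates (R : BiFoxParams p₁ q₁ p₂ q₂ p₃ q₃) (c d : ℝ) : Prop :=
  (∀ i : Fin q₁, i.val < R.m → 0 < R.b i + R.β i * c + R.B i * d) ∧
    (∀ i : Fin p₁, i.val < R.n → 0 < 1 - R.a i - R.α i * c - R.A i * d) ∧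
    R.P.Separates c ∧ R.Q.Separates d

/-- The integrand `kernel(v, w) x^{-v} y^{-w}` at `v = c + j t.1`, `w = d + j t.2`. -/
def integrand (R : BiFoxParams p₁ q₁ p₂ q₂ p₃ q₃) (c d x y : ℝ) (t : ℝ × ℝ) : ℂ :=
  R.kernel (c + t.1 * Complex.I) (d + t.2 * Complex.I) *
    (x : ℂ) ^ (-(c + t.1 * Complex.I)) * (y : ℂ) ^ (-(d + t.2 * Complex.I))

/-- The bivariate Fox H-function
`(2πj)⁻² ∫_{Re v = c} ∫_{Re w = d} kernel(v, w) x^{-v} y^{-w} dv dw`. -/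
def foxH (R : BiFoxParams p₁ q₁ p₂ q₂ p₃ q₃) (c d x y : ℝ) : ℂ :=
  1 / (2 * Real.pi) ^ 2 * ∫ t : ℝ × ℝ, R.integrand c d x y t

end BiFoxParams

/-- The parameters of the bivariate H-function of the capacity formula: orders
`0,1 : m+1,n : 1,1` and `1,0 : p,q+1 : 1,2`, the coupled triple `(1; 1, 1)`, first kernel
`Ψ ; (0,1), Υ`, second kernel `(1,1) ; (1,1), (0,1)`. -/
def capacityParams {p q : ℕ} (P : FoxParams p q) : BiFoxParams 1 0 p (q + 1) 1 2 where
  m := 0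
  n := 1
  a := ![1]
  α := ![1]
  A := ![1]
  b := ![]
  β := ![]
  B := ![]
  P := P.shift
  Q := { m := 1, n := 1, a := ![1], A := ![1], b := ![1, 0], B := ![1, 1] }

/-- The SINR `ω / (ϱ + τ / γ)` of the impaired link at the ideal SNR `γ`. -/
def sinr (ω ϱ τ γ : ℝ) : ℝ := ω / (ϱ + τ / γ)

/-- The cumulative distribution function `x ↦ ℙ(X ≤ x)` of a real random variable. -/
def distribFun {Ω : Type*} [MeasurableSpace Ω] (μ : Measure Ω) (X : Ω → ℝ) (x : ℝ) : ℝ :=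
  μ.real {o | X o ≤ x}

/-- The ergodic capacity `(1 / log 2) ∫_0^r log(1 + x) F'(x) dx` under optimal rate adaptation,
for an SINR with distribution function `F` and upper bound `r`. -/
def oraCapacity (F : ℝ → ℝ) (r : ℝ) : ℝ :=
  1 / Real.log 2 * ∫ x in (0 : ℝ)..r, Real.log (1 + x) * deriv F x

end

noncomputable section

open Filter Topology Set

/-! Write r = ω/ϱ. The SINR increases with the SNR, so for x < r its distribution function at x is
that of the SNR at τ/ϱ · x/(r - x). Integrating by parts against log(1 + x), with F - 1 as the
primitive so that both boundary terms vanish, turns the capacity integral into the integral over (0,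
r) of (1 - F)/(1 + x) (`integral_log_mul_deriv_distribFun_sinr`).

The tail 1 - F of the SNR is a combination of H-functions with kernel Θ(v + 1)/v. Integrating x^(-s)
over [a, b] under the Mellin–Barnes integral produces (a^(1-s) - b^(1-s))/(s - 1). Moving the line
Re s = σ to Re s = c + 1 and putting s = v + 1 gives the kernel, and the term at b vanishes as b → ∞
because c > 0 (`intervalIntegral_foxH`, `one_sub_distribFun_eq_sum_foxH`). The move
(`integral_vertical_eq`) has only absolute convergence on the two lines and an exponential growth
bound between them. A factor exp(ε s²) therefore supplies the decay, and ε → 0 at the end.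

Finally put x = r t and exchange integrals. The factor 1/(1 + r t) has the Mellin–Barnes kernel Γ(1
+ w) Γ(-w), and the remaining t-integral is the beta integral Γ(-v - w) Γ(v + 1)/Γ(1 - w). Since Γ(v
+ 1)/v = Γ(v), the bivariate kernel appears (`integral_beta_div_one_add`, `integral_ccdf_foxH_mul`).
-/

/-! ### Bounds for Γ and 1/Γ on vertical strips. -/

theorem Complex.norm_Gamma_le_Gamma_re {s : ℂ} (hs : 0 < s.re) : ‖Complex.Gamma s‖ ≤ Real.Gamma s.re := by
  rw [Complex.Gamma_eq_integral hs, Real.Gamma_eq_integral hs, Complex.GammaIntegral]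
  refine (norm_integral_le_integral_norm _).trans (le_of_eq ?_)
  refine setIntegral_congr_fun measurableSet_Ioi fun x hx => ?_
  have hx : 0 < x := hx
  simp only [norm_mul, Complex.norm_cpow_eq_rpow_re_of_pos hx, Complex.norm_real, Complex.sub_re,
    Complex.one_re, Real.norm_eq_abs, abs_of_pos (Real.exp_pos _)]

theorem exists_norm_Gamma_le {K : Set ℝ} (hK : IsCompact K) (hpos : ∀ x ∈ K, 0 < x) :
    ∃ C, 0 ≤ C ∧ ∀ s : ℂ, s.re ∈ K → ‖Complex.Gamma s‖ ≤ C := by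
  have hc : ContinuousOn Real.Gamma K := fun x hx =>
    (Real.differentiableAt_Gamma fun m => by
      have := hpos x hx
      have : (0 : ℝ) ≤ m := m.cast_nonneg
      linarith).continuousAt.continuousWithinAt
  obtain ⟨C, hC⟩ := hK.exists_bound_of_continuousOn hc
  refine ⟨max C 0, le_max_right _ _, fun s hs => ?_⟩
  exact (Complex.norm_Gamma_le_Gamma_re (hpos _ hs)).trans
    (((Real.le_norm_self _).trans (hC _ hs)).trans (le_max_left _ _))

theorem Complex.norm_sin_le (z : ℂ) : ‖Complex.sin z‖ ≤ Real.exp |z.im| := by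
  have h1 : ‖Complex.exp (-z * Complex.I)‖ ≤ Real.exp |z.im| := by
    rw [Complex.norm_exp]; simpa using le_abs_self z.im
  have h2 : ‖Complex.exp (z * Complex.I)‖ ≤ Real.exp |z.im| := by
    rw [Complex.norm_exp]; simpa using neg_le_abs z.im
  rw [Complex.sin, norm_div, norm_mul, Complex.norm_I, Complex.norm_two, mul_one]
  have := norm_sub_le (Complex.exp (-z * Complex.I)) (Complex.exp (z * Complex.I))
  linarith

/-- For Re z ≤ 1/2 the reflection formula gives 1/Γ(z) = Γ(1 - z) sin(πz)/π, with Γ(1 - z) bounded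
and the sine of size at most exp(π|Im z|). The recurrence Γ(z) = (z - 1)Γ(z - 1) carries the bound
to the right one unit at a time, with the same constant because |z - 1| ≥ |Im z| ≥ 1. `R` is
quantified inside the induction since each step uses the hypothesis at `R + 1`. -/
theorem exists_norm_inv_Gamma_le_of_one_le (k : ℕ) : ∀ R : ℝ, ∃ C, 0 ≤ C ∧ ∀ z : ℂ, -R ≤ z.re →
    z.re ≤ k + 1 / 2 → 1 ≤ |z.im| → ‖(Complex.Gamma z)⁻¹‖ ≤ C * Real.exp (Real.pi * |z.im|) := by
  induction k with
  | zero =>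
    intro R
    obtain ⟨C, hC0, hC⟩ := exists_norm_Gamma_le (K := Icc (1 / 2) (1 + R)) isCompact_Icc
      fun x hx => by have := hx.1; linarith
    refine ⟨C / Real.pi, by positivity, fun z h1 h2 h3 => ?_⟩
    have hz : z.im ≠ 0 := by intro h; rw [h] at h3; norm_num at h3
    have hG : Complex.Gamma z ≠ 0 := Complex.Gamma_ne_zero fun m h => hz (by rw [h]; simp)
    have hG' : Complex.Gamma (1 - z) ≠ 0 := Complex.Gamma_ne_zero fun m h => hz (by
      have := congrArg Complex.im h
      simpa using this)
    have hr := Complex.Gamma_mul_Gamma_one_sub z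
    have hs : Complex.sin (Real.pi * z) ≠ 0 := by
      intro h
      rw [h, div_zero] at hr
      exact (mul_ne_zero hG hG') hr
    have hpi : (Real.pi : ℂ) ≠ 0 := by exact_mod_cast Real.pi_ne_zero
    have heq : (Complex.Gamma z)⁻¹ = Complex.Gamma (1 - z) * Complex.sin (Real.pi * z) / Real.pi := by
      rw [eq_div_iff hs] at hr
      rw [eq_div_iff hpi, inv_mul_eq_iff_eq_mul₀ hG]
      linear_combination -hr
    rw [heq, norm_div, norm_mul, Complex.norm_real, Real.norm_of_nonneg Real.pi_pos.le]
    have h4 : ‖Complex.Gamma (1 - z)‖ ≤ C := hC _ (by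
      simp only [Complex.sub_re, Complex.one_re, mem_Icc]
      constructor
      · norm_num at h2; linarith
      · linarith)
    have h5 := Complex.norm_sin_le (Real.pi * z)
    have h6 : |((Real.pi : ℂ) * z).im| = Real.pi * |z.im| := by
      simp [abs_mul, abs_of_pos Real.pi_pos]
    rw [h6] at h5
    rw [div_mul_eq_mul_div]
    gcongr
  | succ k ih =>
    intro R
    obtain ⟨C, hC0, hC⟩ := ih (R + 1)
    refine ⟨C, hC0, fun z h1 h2 h3 => ?_⟩
    have hz : z - 1 ≠ 0 := by
      intro h
      have := congrArg Complex.im h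
      simp only [Complex.sub_im, Complex.one_im, sub_zero, Complex.zero_im] at this
      rw [this] at h3
      norm_num at h3
    have h4 : Complex.Gamma z = (z - 1) * Complex.Gamma (z - 1) := by
      rw [← Complex.Gamma_add_one _ hz, sub_add_cancel]
    have h5 : 1 ≤ ‖z - 1‖ := by
      have := Complex.abs_im_le_norm (z - 1)
      simp only [Complex.sub_im, Complex.one_im, sub_zero] at this
      linarith
    have h6 := hC (z - 1) (by simp; linarith) (by simp; push_cast at h2; linarith) (by simpa using h3)
    simp only [Complex.sub_im, Complex.one_im, sub_zero] at h6
    rw [h4, mul_inv, norm_mul, norm_inv]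
    calc ‖z - 1‖⁻¹ * ‖(Complex.Gamma (z - 1))⁻¹‖ ≤ 1 * ‖(Complex.Gamma (z - 1))⁻¹‖ := by
          gcongr; exact inv_le_one_of_one_le₀ h5
      _ ≤ _ := by rw [one_mul]; exact h6

/-- Near the real axis the bound comes from compactness, 1/Γ being entire. -/
theorem exists_norm_inv_Gamma_le (R : ℝ) : ∃ C, 0 ≤ C ∧ ∀ z : ℂ, |z.re| ≤ R →
    ‖(Complex.Gamma z)⁻¹‖ ≤ C * Real.exp (Real.pi * |z.im|) := by
  obtain ⟨k, hk⟩ := exists_nat_ge R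
  obtain ⟨C, hC0, hC⟩ := exists_norm_inv_Gamma_le_of_one_le k R
  have hcomp : IsCompact (Icc (-R) R ×ℂ Icc (-1) 1) := isCompact_Icc.reProdIm isCompact_Icc
  obtain ⟨D, hD⟩ := hcomp.exists_bound_of_continuousOn
    Complex.differentiable_one_div_Gamma.continuous.continuousOn
  refine ⟨max C D, hC0.trans (le_max_left _ _), fun z hz => ?_⟩
  rw [abs_le] at hz
  rcases le_total 1 |z.im| with h | h
  · refine (hC z hz.1 (by linarith) h).trans ?_
    gcongr
    exact le_max_left _ _
  · have h1 := hD z ⟨hz, abs_le.1 h⟩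
    have h2 : 1 ≤ Real.exp (Real.pi * |z.im|) := Real.one_le_exp (by positivity)
    calc _ ≤ D := h1
      _ ≤ max C D := le_max_right _ _
      _ ≤ _ := le_mul_of_one_le_right (hC0.trans (le_max_left _ _)) h2

/-! ### Exponential growth on strips and displacement of vertical contours. -/

/-- `G` grows at most exponentially in the imaginary direction on the strip `re ⁻¹' S`. -/
def ExpGrowth (S : Set ℝ) (G : ℂ → ℂ) : Prop :=
  ∃ C K : ℝ, 0 ≤ C ∧ 0 ≤ K ∧ ∀ s : ℂ, s.re ∈ S → ‖G s‖ ≤ C * Real.exp (K * |s.im|)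

namespace ExpGrowth

variable {S : Set ℝ} {G H : ℂ → ℂ}

theorem of_bounded {C : ℝ} (h : ∀ s : ℂ, s.re ∈ S → ‖G s‖ ≤ C) : ExpGrowth S G :=
  ⟨max C 0, 0, le_max_right _ _, le_rfl, fun s hs => by simpa using .inl (h s hs)⟩

theorem mul (hG : ExpGrowth S G) (hH : ExpGrowth S H) : ExpGrowth S fun s => G s * H s := by
  obtain ⟨C, K, hC, hK, h⟩ := hG
  obtain ⟨C', K', hC', hK', h'⟩ := hH
  refine ⟨C * C', K + K', by positivity, by positivity, fun s hs => ?_⟩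
  rw [norm_mul, add_mul, Real.exp_add]
  calc _ ≤ (C * Real.exp (K * |s.im|)) * (C' * Real.exp (K' * |s.im|)) := by
        gcongr
        exacts [h s hs, h' s hs]
    _ = _ := by ring

theorem prod {ι : Type*} (t : Finset ι) {G : ι → ℂ → ℂ} (h : ∀ i ∈ t, ExpGrowth S (G i)) :
    ExpGrowth S fun s => ∏ i ∈ t, G i s := by
  classical
  induction t using Finset.induction_on with
  | empty => exact of_bounded (C := 1) (by simp)
  | insert i t hi ih =>
    simp only [Finset.prod_insert hi]
    exact (h i (Finset.mem_insert_self _ _)).mul (ih fun j hj => h j (Finset.mem_insert_of_mem hj))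

end ExpGrowth

theorem expGrowth_Gamma {S : Set ℝ} (hS : IsCompact S) {a A : ℝ} (h : ∀ x ∈ S, 0 < a + A * x) :
    ExpGrowth S fun s => Complex.Gamma (a + A * s) := by
  obtain ⟨C, -, hC⟩ := exists_norm_Gamma_le (K := (fun x => a + A * x) '' S)
    (hS.image (by fun_prop)) (by rintro _ ⟨x, hx, rfl⟩; exact h x hx)
  exact .of_bounded (C := C) fun s hs => hC _ ⟨s.re, hs, by simp⟩

theorem expGrowth_inv_Gamma {S : Set ℝ} (hS : IsCompact S) (a A : ℝ) :
    ExpGrowth S fun s => (Complex.Gamma (a + A * s))⁻¹ := by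
  obtain ⟨R, hR⟩ := hS.exists_bound_of_continuousOn (f := fun x => a + A * x) (by fun_prop)
  obtain ⟨C, hC0, hC⟩ := exists_norm_inv_Gamma_le R
  refine ⟨C, Real.pi * |A|, hC0, by positivity, fun s hs => ?_⟩
  refine (hC (a + A * s) (by simpa using hR _ hs)).trans (le_of_eq ?_)
  simp [abs_mul, mul_assoc]

/-- Regularization by a Gaussian makes horizontal sides of rectangles negligible. -/
theorem tendsto_horizontal_gaussian {α β : ℝ} {G : ℂ → ℂ} (hG : ExpGrowth (uIcc α β) G) {ε : ℝ}
    (hε : 0 < ε) (l : Filter ℝ) (hl : Tendsto (fun T => |T|) l atTop) :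
    Tendsto (fun T : ℝ => ∫ x in α..β, G (x + T * Complex.I) *
      Complex.exp (ε * (x + T * Complex.I) ^ 2)) l (𝓝 0) := by
  obtain ⟨C, K, hC, hK, h⟩ := hG
  obtain ⟨M, hM⟩ := (isCompact_uIcc (a := α) (b := β)).exists_bound_of_continuousOn
    (f := fun x : ℝ => x ^ 2) (by fun_prop)
  -- The exponent is K|T| - ε T²: the Gaussian beats any exponential growth.
  have hlim : Tendsto (fun T : ℝ => C * Real.exp (ε * M) * Real.exp (|T| * (K - ε * |T|)) * |β - α|) l
      (𝓝 0) := by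
    have h1 : Tendsto (fun x : ℝ => x * (K - ε * x)) atTop atBot := by
      refine tendsto_id.atTop_mul_atBot₀ ?_
      exact tendsto_atBot_add_const_left _ _ (tendsto_neg_atTop_atBot.comp (tendsto_id.const_mul_atTop hε))
    have h2 := (Real.tendsto_exp_atBot.comp (h1.comp hl)).const_mul (C * Real.exp (ε * M))
    simpa using h2.mul_const |β - α|
  refine squeeze_zero_norm (fun T => ?_) hlim
  refine intervalIntegral.norm_integral_le_of_norm_le_const fun x hx => ?_
  have hx' : x ∈ uIcc α β := uIoc_subset_uIcc hx
  have h1 := h (x + T * Complex.I) (by simpa using hx')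
  have h2 : ‖Complex.exp (ε * (x + T * Complex.I) ^ 2)‖ ≤ Real.exp (ε * M) * Real.exp (-(ε * |T| ^ 2)) := by
    rw [Complex.norm_exp, ← Real.exp_add]
    refine Real.exp_le_exp.2 ?_
    have : (ε * (x + T * Complex.I) ^ 2 : ℂ).re = ε * (x ^ 2 - T ^ 2) := by
      simp [pow_two]
    rw [this, sq_abs]
    have := (Real.le_norm_self _).trans (hM x hx')
    nlinarith
  rw [norm_mul]
  calc _ ≤ (C * Real.exp (K * |T|)) * (Real.exp (ε * M) * Real.exp (-(ε * |T| ^ 2))) := by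
        gcongr; simpa using h1
    _ = C * Real.exp (ε * M) * (Real.exp (K * |T|) * Real.exp (-(ε * |T| ^ 2))) := by ring
    _ = _ := by rw [← Real.exp_add]; ring_nf

/-- The bound does not depend on ε, so it serves as the majorant when ε → 0. -/
theorem norm_gaussian_vertical_le (x y : ℝ) {ε : ℝ} (h0 : 0 ≤ ε) (h1 : ε ≤ 1) :
    ‖Complex.exp (ε * (x + y * Complex.I) ^ 2)‖ ≤ Real.exp (x ^ 2) := by
  rw [Complex.norm_exp]
  refine Real.exp_le_exp.2 ?_
  have : (ε * (x + y * Complex.I) ^ 2 : ℂ).re = ε * (x ^ 2 - y ^ 2) := by simp [pow_two]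
  rw [this]
  nlinarith [sq_nonneg x, sq_nonneg y, mul_nonneg h0 (sq_nonneg y)]

theorem integrable_mul_gaussian_vertical {G : ℂ → ℂ} {x ε : ℝ} (h0 : 0 ≤ ε) (h1 : ε ≤ 1)
    (hG : Integrable fun y : ℝ => G (x + y * Complex.I)) :
    Integrable fun y : ℝ => G (x + y * Complex.I) * Complex.exp (ε * (x + y * Complex.I) ^ 2) :=
  hG.mul_bdd (c := Real.exp (x ^ 2)) (by fun_prop) (ae_of_all _ fun y =>
    norm_gaussian_vertical_le x y h0 h1)

/-- Vertical lines of integration can be moved across a strip of holomorphy and of exponential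
growth, as soon as the integrals along both lines converge absolutely. -/
theorem integral_vertical_eq {α β : ℝ} {G : ℂ → ℂ} (hd : ∀ s : ℂ, s.re ∈ uIcc α β → DifferentiableAt ℂ G s)
    (hG : ExpGrowth (uIcc α β) G) (hα : Integrable fun y : ℝ => G (α + y * Complex.I))
    (hβ : Integrable fun y : ℝ => G (β + y * Complex.I)) :
    ∫ y : ℝ, G (α + y * Complex.I) = ∫ y : ℝ, G (β + y * Complex.I) := by
  have key : ∀ ε : ℝ, 0 < ε → ε ≤ 1 →
      ∫ y : ℝ, G (α + y * Complex.I) * Complex.exp (ε * (α + y * Complex.I) ^ 2) =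
        ∫ y : ℝ, G (β + y * Complex.I) * Complex.exp (ε * (β + y * Complex.I) ^ 2) := by
    intro ε h0 h1
    set F : ℂ → ℂ := fun s => G s * Complex.exp (ε * s ^ 2) with hF
    have hrect : ∀ T : ℝ, (∫ x in α..β, F (x + (-T : ℝ) * Complex.I)) -
        (∫ x in α..β, F (x + T * Complex.I)) + Complex.I • (∫ y in (-T)..T, F (β + y * Complex.I)) -
        Complex.I • ∫ y in (-T)..T, F (α + y * Complex.I) = 0 := by
      intro T
      have := Complex.integral_boundary_rect_eq_zero_of_differentiableOn F ⟨α, -T⟩ ⟨β, T⟩ (by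
        intro s hs
        refine DifferentiableAt.differentiableWithinAt ?_
        exact (hd s hs.1).mul (by fun_prop))
      simpa using this
    have hA := intervalIntegral_tendsto_integral (integrable_mul_gaussian_vertical h0.le h1 hα)
      tendsto_neg_atTop_atBot tendsto_id
    have hB := intervalIntegral_tendsto_integral (integrable_mul_gaussian_vertical h0.le h1 hβ)
      tendsto_neg_atTop_atBot tendsto_id
    have hN := tendsto_horizontal_gaussian hG h0 atTop tendsto_abs_atTop_atTop
    -- Top and bottom sides of the rectangle are the same limit taken along `atTop` and `atBot`.
    have hN' := (tendsto_horizontal_gaussian hG h0 atBot tendsto_abs_atBot_atTop).comp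
      tendsto_neg_atTop_atBot
    have hlim := ((hN'.sub hN).add (hB.const_smul Complex.I)).sub (hA.const_smul Complex.I)
    have hlim' := hlim.congr (f₂ := fun _ => 0) (fun T => hrect T)
    have := tendsto_nhds_unique hlim' tendsto_const_nhds
    rw [sub_zero, zero_add, ← smul_sub, smul_eq_zero] at this
    rcases this with h | h
    · exact absurd h Complex.I_ne_zero
    · exact (sub_eq_zero.1 h).symm
  have hε : Tendsto (fun n : ℕ => 1 / ((n : ℝ) + 1)) atTop (𝓝 0) := tendsto_one_div_add_atTop_nhds_zero_nat
  have lim : ∀ x : ℝ, Integrable (fun y : ℝ => G (x + y * Complex.I)) →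
      Tendsto (fun n : ℕ => ∫ y : ℝ, G (x + y * Complex.I) *
        Complex.exp ((1 / ((n : ℝ) + 1) : ℝ) * (x + y * Complex.I) ^ 2)) atTop
        (𝓝 (∫ y : ℝ, G (x + y * Complex.I))) := by
    intro x hx
    have hn : ∀ n : ℕ, 0 ≤ 1 / ((n : ℝ) + 1) ∧ 1 / ((n : ℝ) + 1) ≤ 1 := fun n =>
      ⟨by positivity, by rw [div_le_one (by positivity)]; linarith [n.cast_nonneg (α := ℝ)]⟩
    refine tendsto_integral_of_dominated_convergence
      (fun y => ‖G (x + y * Complex.I)‖ * Real.exp (x ^ 2))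
      (fun n => (integrable_mul_gaussian_vertical (hn n).1 (hn n).2 hx).1)
      (hx.norm.mul_const _) (fun n => ae_of_all _ fun y => ?_) (ae_of_all _ fun y => ?_)
    · rw [norm_mul]
      gcongr
      exact norm_gaussian_vertical_le x y (hn n).1 (hn n).2
    · have h2 : Tendsto (fun ε : ℝ => G (x + y * Complex.I) *
          Complex.exp (ε * (x + y * Complex.I) ^ 2)) (𝓝 0) (𝓝 (G (x + y * Complex.I))) := by
        have : Continuous fun ε : ℝ => G (x + y * Complex.I) *
          Complex.exp (ε * (x + y * Complex.I) ^ 2) := by fun_prop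
        simpa using this.tendsto 0
      exact h2.comp hε
  refine tendsto_nhds_unique (lim α hα) ((lim β hβ).congr fun n => (key _ (by positivity) ?_).symm)
  rw [div_le_one (by positivity)]; linarith [n.cast_nonneg (α := ℝ)]

/-! ### Univariate Fox kernels and the antiderivative of an H-function. -/

namespace FoxParams

variable {p q : ℕ}

/-- Every factor becomes Γ or 1/Γ at a real affine function of s. Holomorphy and growth can then be
checked factor by factor, and the denominators need no condition because 1/Γ is entire. -/
theorem kernel_eq_mul_inv (P : FoxParams p q) (s : ℂ) : P.kernel s =
    ((∏ i : Fin q with i.val < P.m, Complex.Gamma (P.b i + P.B i * s)) *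
      ∏ i : Fin p with i.val < P.n, Complex.Gamma ((1 - P.a i : ℝ) + (-P.A i : ℝ) * s)) *
    ((∏ i : Fin p with P.n ≤ i.val, (Complex.Gamma (P.a i + P.A i * s))⁻¹) *
      ∏ i : Fin q with P.m ≤ i.val, (Complex.Gamma ((1 - P.b i : ℝ) + (-P.B i : ℝ) * s))⁻¹) := by
  simp only [kernel, div_eq_mul_inv, mul_inv, Finset.prod_inv_distrib]
  push_cast
  simp only [neg_mul, ← sub_eq_add_neg]

/-- The separation conditions are strict affine inequalities in the abscissa, hence convex. The
whole strip between two contours is therefore free of poles. -/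
theorem Separates.of_mem_uIcc {P : FoxParams p q} {α β x : ℝ} (hα : P.Separates α)
    (hβ : P.Separates β) (hx : x ∈ uIcc α β) : P.Separates x := by
  rw [← segment_eq_uIcc] at hx
  obtain ⟨u, v, hu, hv, huv, rfl⟩ := hx
  have aux : ∀ r t : ℝ, 0 < r → 0 < t → 0 < u * r + v * t := by
    intro r t hr ht
    rcases hu.eq_or_lt with h | h
    · have : v = 1 := by linarith
      rw [← h, this]; linarith
    · have := mul_pos h hr
      have := mul_nonneg hv ht.le
      linarith
  refine ⟨fun i hi => ?_, fun i hi => ?_⟩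
  · refine (aux _ _ (hα.1 i hi) (hβ.1 i hi)).trans_eq ?_
    simp only [smul_eq_mul]
    linear_combination P.b i * huv
  · refine (aux _ _ (hα.2 i hi) (hβ.2 i hi)).trans_eq ?_
    simp only [smul_eq_mul]
    linear_combination (1 - P.a i) * huv

theorem differentiableAt_kernel {P : FoxParams p q} {s : ℂ} (hs : P.Separates s.re) :
    DifferentiableAt ℂ P.kernel s := by
  have hG : ∀ a A : ℝ, 0 < a + A * s.re →
      DifferentiableAt ℂ (fun s : ℂ => Complex.Gamma (a + A * s)) s := by
    intro a A h
    refine DifferentiableAt.comp s (Complex.differentiableAt_Gamma _ fun m hm => ?_)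
      (f := fun s : ℂ => (a : ℂ) + A * s) (by fun_prop)
    have := congrArg Complex.re hm
    simp only [Complex.add_re, Complex.ofReal_re, Complex.re_ofReal_mul, Complex.neg_re,
      Complex.natCast_re] at this
    have : (0 : ℝ) ≤ m := m.cast_nonneg
    linarith
  have hI : ∀ a A : ℝ, DifferentiableAt ℂ (fun s : ℂ => (Complex.Gamma (a + A * s))⁻¹) s :=
    fun a A => (Complex.differentiable_one_div_Gamma _).comp s
      (f := fun s : ℂ => (a : ℂ) + A * s) (by fun_prop)
  rw [funext P.kernel_eq_mul_inv]
  refine .mul (.mul ?_ ?_) (.mul ?_ ?_) <;> refine .fun_finsetProd fun i hi => ?_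
  · exact hG _ _ (hs.1 i (by simpa using hi))
  · refine hG _ _ ?_
    have := hs.2 i (by simpa using hi)
    linarith
  · exact hI _ _
  · exact hI _ _

theorem expGrowth_kernel {P : FoxParams p q} {S : Set ℝ} (hS : IsCompact S)
    (h : ∀ x ∈ S, P.Separates x) : ExpGrowth S P.kernel := by
  rw [funext P.kernel_eq_mul_inv]
  refine .mul (.mul ?_ ?_) (.mul ?_ ?_) <;> refine .prod _ fun i hi => ?_
  · exact expGrowth_Gamma hS fun x hx => (h x hx).1 i (by simpa using hi)
  · refine expGrowth_Gamma hS fun x hx => ?_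
    have := (h x hx).2 i (by simpa using hi)
    linarith
  · exact expGrowth_inv_Gamma hS _ _
  · exact expGrowth_inv_Gamma hS _ _

theorem shift_kernel (P : FoxParams p q) (v : ℂ) :
    P.shift.kernel v = Complex.Gamma v * P.kernel (v + 1) := by
  simp only [kernel, Finset.prod_filter]
  simp only [shift, Fin.prod_univ_succ, Fin.cons_zero, Fin.cons_succ, Fin.val_zero, Fin.val_succ]
  simp only [Nat.succ_pos, if_true, Nat.add_lt_add_iff_right, Nat.add_le_add_iff_right,
    if_false, one_mul, Complex.ofReal_zero, Complex.ofReal_one, zero_add,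
    Nat.le_zero_eq, Nat.add_eq_zero_iff, one_ne_zero, and_false]
  have h1 : ∀ i, ((P.b i + P.B i : ℝ) : ℂ) + P.B i * v = P.b i + P.B i * (v + 1) := by
    intro i; push_cast; ring
  have h2 : ∀ i, (1 : ℂ) - (P.b i + P.B i : ℝ) - P.B i * v = 1 - P.b i - P.B i * (v + 1) := by
    intro i; push_cast; ring
  have h3 : ∀ i, ((P.a i + P.A i : ℝ) : ℂ) + P.A i * v = P.a i + P.A i * (v + 1) := by
    intro i; push_cast; ring
  have h4 : ∀ i, (1 : ℂ) - (P.a i + P.A i : ℝ) - P.A i * v = 1 - P.a i - P.A i * (v + 1) := by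
    intro i; push_cast; ring
  simp only [h1, h2, h3, h4]
  ring

/-- The extra upper pair (1,1) has index p ≥ n, so it lies in the denominator and contributes Γ(1 +
v). Against the factor Γ(v) of the pair (0,1) this leaves 1/v. -/
theorem ccdf_kernel (P : FoxParams p q) (hn : P.n ≤ p) {v : ℂ} (hv : 0 < v.re) :
    P.ccdf.kernel v = P.kernel (v + 1) / v := by
  have h : P.ccdf.kernel v = P.shift.kernel v / Complex.Gamma (1 + v) := by
    simp only [kernel, Finset.prod_filter]
    simp only [shift, ccdf, Fin.prod_univ_castSucc (n := p),
      Fin.snoc_castSucc, Fin.snoc_last, Fin.val_castSucc, Fin.val_last, hn, hn.not_gt, if_true,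
      if_false, Complex.ofReal_one, one_mul, mul_one]
    rw [div_div]
    congr 1
    exact mul_right_comm _ _ _
  have hv0 : v ≠ 0 := by rintro rfl; simp at hv
  rw [h, shift_kernel, add_comm 1 v, Complex.Gamma_add_one _ hv0]
  have := Complex.Gamma_ne_zero_of_re_pos hv
  field_simp

theorem ccdf_separates {P : FoxParams p q} {c : ℝ} (h : P.ccdf.Separates c) :
    0 < c ∧ P.Separates (c + 1) := by
  obtain ⟨h1, h2⟩ := h
  refine ⟨by simpa [ccdf] using h1 0 (by simp [ccdf]), fun i hi => ?_, fun i hi => ?_⟩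
  · have := h1 i.succ (by simpa [ccdf] using hi)
    simp only [ccdf, Fin.cons_succ] at this
    linarith
  · have := h2 i.castSucc (by simpa [ccdf] using hi)
    simp only [ccdf, Fin.snoc_castSucc] at this
    linarith

theorem norm_ofReal_cpow_vertical {x : ℝ} (hx : 0 < x) (c y : ℝ) :
    ‖(x : ℂ) ^ (-((c : ℂ) + y * Complex.I))‖ = x ^ (-c) := by
  rw [Complex.norm_cpow_eq_rpow_re_of_pos hx]
  simp

theorem continuous_cpow_vertical {x : ℝ} (hx : 0 < x) (c : ℝ) :
    Continuous fun y : ℝ => (x : ℂ) ^ (-((c : ℂ) + y * Complex.I)) :=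
  Continuous.const_cpow (by fun_prop) (.inl (by exact_mod_cast hx.ne'))

theorem norm_foxH_le (P : FoxParams p q) (σ : ℝ) {x : ℝ} (hx : 0 < x) :
    ‖P.foxH σ x‖ ≤ 1 / (2 * Real.pi) * (∫ y : ℝ, ‖P.kernel (σ + y * Complex.I)‖) * x ^ (-σ) := by
  rw [foxH, norm_mul, mul_assoc]
  have : ‖(1 / (2 * Real.pi) : ℂ)‖ = 1 / (2 * Real.pi) := by
    simp [abs_of_pos Real.pi_pos]
  rw [this]
  gcongr
  refine (norm_integral_le_integral_norm _).trans_eq ?_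
  simp only [norm_mul, norm_ofReal_cpow_vertical hx, integral_mul_const]

theorem continuousAt_foxH {P : FoxParams p q} {σ : ℝ}
    (h : Integrable fun y : ℝ => P.kernel (σ + y * Complex.I)) {x : ℝ} (hx : 0 < x) :
    ContinuousAt (P.foxH σ) x := by
  obtain ⟨C, hC⟩ := (isCompact_Icc (a := x / 2) (b := 2 * x)).exists_bound_of_continuousOn
    (f := fun u : ℝ => u ^ (-σ)) (fun u hu => (Real.continuousAt_rpow_const _ _
      (.inl (by have := hu.1; exact ne_of_gt (by linarith)))).continuousWithinAt)
  refine ContinuousAt.mul continuousAt_const ?_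
  refine continuousAt_of_dominated (bound := fun y => ‖P.kernel (σ + y * Complex.I)‖ * C) ?_ ?_
    (h.norm.mul_const _) (ae_of_all _ fun y => ?_)
  · filter_upwards [lt_mem_nhds hx] with u hu
    exact h.1.mul (continuous_cpow_vertical hu σ).aestronglyMeasurable
  · filter_upwards [Icc_mem_nhds (show x / 2 < x by linarith) (show x < 2 * x by linarith)] with u hu
    have hu0 : 0 < u := by have := hu.1; linarith
    refine ae_of_all _ fun y => ?_
    rw [norm_mul, norm_ofReal_cpow_vertical hu0]
    gcongr
    exact (Real.le_norm_self _).trans (hC u hu)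
  · refine continuousAt_const.mul ?_
    exact (Complex.continuousAt_ofReal_cpow_const _ _ (.inr hx.ne'))

/-- The entire function `s ↦ ∫ₐᵇ x ^ (-s) dx`. -/
def cpowIntegral (a b : ℝ) (s : ℂ) : ℂ := ∫ x in a..b, (x : ℂ) ^ (-s)

theorem sub_one_mul_cpowIntegral {a b : ℝ} (ha : 0 < a) (hab : a ≤ b) {s : ℂ} (hs : s ≠ 1) :
    (s - 1) * cpowIntegral a b s = (a : ℂ) ^ (-(s - 1)) - (b : ℂ) ^ (-(s - 1)) := by
  have h0 : (0 : ℝ) ∉ uIcc a b := by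
    rw [uIcc_of_le hab]; exact fun h => (ha.trans_le h.1).false
  rw [cpowIntegral, integral_cpow (.inr ⟨fun h => hs (neg_injective h), h0⟩)]
  have h1 : -s + 1 ≠ 0 := fun h => hs (by linear_combination -h)
  rw [mul_div_assoc', div_eq_iff h1, show -(s - 1) = -s + 1 by ring]
  ring

/-- The integral is the Mellin transform, at 1 - s, of the indicator of (a, b], which vanishes near
0 and near ∞. -/
theorem differentiable_cpowIntegral {a b : ℝ} (ha : 0 < a) (hab : a ≤ b) :
    Differentiable ℂ (cpowIntegral a b) := by
  have heq : cpowIntegral a b = fun s =>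
      mellin (indicator (Ioc a b) fun _ => (1 : ℂ)) (1 - s) := by
    ext s
    rw [cpowIntegral, mellin, intervalIntegral.integral_of_le hab]
    have : ∀ t : ℝ, (t : ℂ) ^ (1 - s - 1) • (Ioc a b).indicator (fun _ => (1 : ℂ)) t =
        (Ioc a b).indicator (fun t : ℝ => (t : ℂ) ^ (-s)) t := by
      intro t
      by_cases ht : t ∈ Ioc a b <;> simp [ht]
    simp only [this]
    rw [setIntegral_indicator measurableSet_Ioc,
      inter_eq_self_of_subset_right (show Ioc a b ⊆ Ioi 0 from fun x hx => ha.trans hx.1)]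
  rw [heq]
  intro s
  refine DifferentiableAt.comp s (g := mellin (indicator (Ioc a b) fun _ => (1 : ℂ)))
    (f := fun s : ℂ => 1 - s) ?_ (by fun_prop)
  -- Any two exponents on either side of Re(1 - s) would do.
  refine mellin_differentiableAt_of_isBigO_rpow (a := (1 - s).re + 1) (b := (1 - s).re - 1)
    ?_ ?_ (by linarith) ?_ (by linarith)
  · refine (Integrable.locallyIntegrable ?_).locallyIntegrableOn _
    exact (integrable_indicator_iff measurableSet_Ioc).2 (integrableOn_const (by simp))
  · refine (Asymptotics.isBigO_zero _ _).congr' ?_ .rfl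
    filter_upwards [eventually_gt_atTop b] with x hx
    exact (indicator_of_notMem (fun h => (hx.trans_le h.2).false) _).symm
  · refine (Asymptotics.isBigO_zero _ _).congr' ?_ .rfl
    filter_upwards [mem_nhdsWithin_of_mem_nhds (Iio_mem_nhds ha)] with x hx
    exact (indicator_of_notMem (fun h => (lt_trans hx h.1).false) _).symm

theorem exists_norm_cpowIntegral_le {a b : ℝ} (ha : 0 < a) (hab : a ≤ b) {S : Set ℝ}
    (hS : IsCompact S) : ∃ C, ∀ s : ℂ, s.re ∈ S → ‖cpowIntegral a b s‖ ≤ C := by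
  have hc : ContinuousOn (fun z : ℝ × ℝ => z.1 ^ (-z.2)) (Icc a b ×ˢ S) := fun z hz =>
    ((Real.continuousAt_rpow (z.1, -z.2) (.inl (ha.trans_le hz.1.1).ne')).comp
      (f := fun z : ℝ × ℝ => (z.1, -z.2)) (by fun_prop)).continuousWithinAt
  obtain ⟨C, hC⟩ := (isCompact_Icc.prod hS).exists_bound_of_continuousOn hc
  refine ⟨C * |b - a|, fun s hs => intervalIntegral.norm_integral_le_of_norm_le_const fun x hx => ?_⟩
  rw [uIoc_of_le hab] at hx
  rw [Complex.norm_cpow_eq_rpow_re_of_pos (ha.trans hx.1)]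
  exact (Real.le_norm_self _).trans (hC (x, s.re) ⟨⟨hx.1.le, hx.2⟩, hs⟩)

theorem intervalIntegral_foxH_eq {P : FoxParams p q} {σ : ℝ}
    (h : Integrable fun y : ℝ => P.kernel (σ + y * Complex.I)) {a b : ℝ} (ha : 0 < a) (hab : a ≤ b) :
    ∫ x in a..b, P.foxH σ x = 1 / (2 * Real.pi) *
      ∫ y : ℝ, P.kernel (σ + y * Complex.I) * cpowIntegral a b (σ + y * Complex.I) := by
  simp only [foxH]
  rw [intervalIntegral.integral_const_mul]
  congr 1
  simp only [cpowIntegral, ← intervalIntegral.integral_const_mul]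
  simp only [intervalIntegral.integral_of_le hab]
  refine integral_integral_swap ?_
  have hb : Integrable (fun z : ℝ × ℝ => P.kernel (σ + z.2 * Complex.I))
      ((volume.restrict (Ioc a b)).prod volume) :=
    h.comp_snd _
  obtain ⟨C, hC⟩ := (isCompact_Icc (a := a) (b := b)).exists_bound_of_continuousOn
    (f := fun u : ℝ => u ^ (-σ)) (fun u hu => (Real.continuousAt_rpow_const _ _
      (.inl (ha.trans_le hu.1).ne')).continuousWithinAt)
  refine hb.mul_bdd (c := C) ?_ ?_
  · refine Measurable.aestronglyMeasurable ?_
    fun_prop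
  · have : ∀ᵐ x ∂(volume.restrict (Ioc a b)), x ∈ Ioc a b := ae_restrict_mem measurableSet_Ioc
    filter_upwards [Measure.quasiMeasurePreserving_fst.ae this] with z hz
    rw [norm_ofReal_cpow_vertical (ha.trans hz.1)]
    exact (Real.le_norm_self _).trans (hC _ ⟨hz.1.le, hz.2⟩)

/-- The H-function with parameters `P.ccdf` is an antiderivative of `-P.foxH`. -/
theorem intervalIntegral_foxH {P : FoxParams p q} (hn : P.n ≤ p) {σ c : ℝ} (hσ : P.IsContour σ)
    (hc : P.ccdf.IsContour c) {a b : ℝ} (ha : 0 < a) (hab : a ≤ b) :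
    ∫ x in a..b, P.foxH σ x = P.ccdf.foxH c a - P.ccdf.foxH c b := by
  obtain ⟨hc0, hc1⟩ := ccdf_separates hc.1
  have hb : 0 < b := ha.trans_le hab
  obtain ⟨C, hC⟩ := exists_norm_cpowIntegral_le ha hab (isCompact_uIcc (a := σ) (b := c + 1))
  have hsep : ∀ x ∈ uIcc σ (c + 1), P.Separates x := fun x hx => hσ.1.of_mem_uIcc hc1 hx
  have hcont : Continuous fun y : ℝ => cpowIntegral a b (σ + y * Complex.I) :=
    (differentiable_cpowIntegral ha hab).continuous.comp (by fun_prop)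
  have hline : ∀ y : ℝ, P.kernel (((c + 1 : ℝ) : ℂ) + y * Complex.I) *
      cpowIntegral a b (((c + 1 : ℝ) : ℂ) + y * Complex.I) =
      P.ccdf.kernel (c + y * Complex.I) * (a : ℂ) ^ (-(c + y * Complex.I)) -
      P.ccdf.kernel (c + y * Complex.I) * (b : ℂ) ^ (-(c + y * Complex.I)) := by
    intro y
    have hre : 0 < ((c : ℂ) + y * Complex.I).re := by simpa using hc0
    set v : ℂ := c + y * Complex.I with hv
    have hv0 : v ≠ 0 := by intro h; rw [h] at hre; simp at hre
    have hs : ((c + 1 : ℝ) : ℂ) + y * Complex.I = v + 1 := by rw [hv]; push_cast; ring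
    have := sub_one_mul_cpowIntegral ha hab (s := v + 1) (by simpa using hv0)
    rw [add_sub_cancel_right] at this
    rw [hs, ccdf_kernel P hn hre, ← mul_sub, ← this]
    field_simp
  have hia : ∀ {x : ℝ}, 0 < x → Integrable fun y : ℝ =>
      P.ccdf.kernel (c + y * Complex.I) * (x : ℂ) ^ (-((c : ℂ) + y * Complex.I)) := fun {x} hx =>
    hc.2.mul_bdd (c := x ^ (-c)) (continuous_cpow_vertical hx c).aestronglyMeasurable
      (ae_of_all _ fun y => (norm_ofReal_cpow_vertical hx c y).le)
  rw [intervalIntegral_foxH_eq hσ.2 ha hab]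
  -- The integrand is kept as the kernel times an entire function, so σ may lie on either side of 1:
  -- there is no pole at s = 1 to cross. The division by s - 1 happens only on the line Re s = c + 1
  -- > 1.
  rw [integral_vertical_eq (α := σ) (β := c + 1) (G := fun s => P.kernel s * cpowIntegral a b s)]
  · simp only [hline]
    rw [integral_sub (hia ha) (hia hb), mul_sub]
    rfl
  · exact fun s hs => (differentiableAt_kernel (hsep _ hs)).mul (differentiable_cpowIntegral ha hab s)
  · exact (expGrowth_kernel isCompact_uIcc hsep).mul (.of_bounded hC)
  · exact hσ.2.mul_bdd (c := C) hcont.aestronglyMeasurable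
      (ae_of_all _ fun y => hC _ (by simp))
  · simp only [hline]
    exact (hia ha).sub (hia hb)

theorem intervalIntegral_foxH_scaled {P : FoxParams p q} (hn : P.n ≤ p) {σ c : ℝ}
    (hσ : P.IsContour σ) (hc : P.ccdf.IsContour c) {k : ℝ} (hk : 0 < k) {a b : ℝ} (ha : 0 < a)
    (hab : a ≤ b) :
    ∫ x in a..b, P.foxH σ (k * x) = 1 / k * (P.ccdf.foxH c (k * a) - P.ccdf.foxH c (k * b)) := by
  rw [intervalIntegral.integral_comp_mul_left _ hk.ne',
    intervalIntegral_foxH hn hσ hc (by positivity) (by gcongr), Complex.real_smul]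
  push_cast
  rw [one_div]

end FoxParams

/-! ### The Mellin–Barnes representation of 1/(1 + x) and the beta integral. -/

theorem Continuous.complexGamma {X : Type*} [TopologicalSpace X] {f : X → ℂ} (hf : Continuous f)
    (h : ∀ x, 0 < (f x).re) : Continuous fun x => Complex.Gamma (f x) :=
  continuous_iff_continuousAt.2 fun x =>
    (Complex.differentiableAt_Gamma _ fun m hm => by
      have h1 := h x
      have := congrArg Complex.re hm
      simp only [Complex.neg_re, Complex.natCast_re] at this
      have : (0 : ℝ) ≤ m := m.cast_nonneg
      linarith).continuousAt.comp hf.continuousAt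

theorem vertical_ne_zero {a : ℝ} (ha : a ≠ 0) (y : ℝ) : (a : ℂ) + y * Complex.I ≠ 0 := fun h =>
  ha (by simpa using congrArg Complex.re h)

theorem continuous_inv_mul_vertical {a b : ℝ} (ha : a ≠ 0) (hb : b ≠ 0) :
    Continuous fun y : ℝ => (((a : ℂ) + y * Complex.I) * (b + y * Complex.I))⁻¹ :=
  Continuous.inv₀ (by fun_prop) fun y => mul_ne_zero (vertical_ne_zero ha y) (vertical_ne_zero hb y)

theorem integrable_inv_mul_vertical {a b : ℝ} (ha : a ≠ 0) (hb : b ≠ 0) :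
    Integrable fun y : ℝ => (((a : ℂ) + y * Complex.I) * (b + y * Complex.I))⁻¹ := by
  -- Each linear factor is bounded below by a multiple of √(1 + y²), so the product of two is
  -- comparable with 1 + y².
  have key : ∀ {a : ℝ}, a ≠ 0 → ∀ y : ℝ,
      min |a| 1 * Real.sqrt (1 + y ^ 2) ≤ ‖(a : ℂ) + y * Complex.I‖ := by
    intro a ha y
    rw [Complex.norm_add_mul_I]
    refine Real.le_sqrt_of_sq_le ?_
    rw [mul_pow, Real.sq_sqrt (by positivity)]
    have h0 : 0 ≤ min |a| 1 := le_min (abs_nonneg _) zero_le_one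
    have h1 : min |a| 1 ^ 2 ≤ a ^ 2 := by
      rw [← sq_abs a]; gcongr; exact min_le_left _ _
    have h2 : min |a| 1 ^ 2 ≤ 1 := pow_le_one₀ h0 (min_le_right _ _)
    nlinarith [mul_le_mul_of_nonneg_right h2 (sq_nonneg y)]
  have hpos : ∀ {a : ℝ}, a ≠ 0 → 0 < min |a| 1 := fun ha => lt_min (abs_pos.2 ha) one_pos
  refine (integrable_inv_one_add_sq.const_mul (min |a| 1 * min |b| 1)⁻¹).mono'
    (continuous_inv_mul_vertical ha hb).aestronglyMeasurable (ae_of_all _ fun y => ?_)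
  rw [norm_inv, ← mul_inv, norm_mul]
  have h1 := hpos ha
  have h2 := hpos hb
  have : min |a| 1 * min |b| 1 * (1 + y ^ 2) =
      (min |a| 1 * Real.sqrt (1 + y ^ 2)) * (min |b| 1 * Real.sqrt (1 + y ^ 2)) := by
    nth_rewrite 1 [← Real.mul_self_sqrt (show 0 ≤ 1 + y ^ 2 by positivity)]
    ring
  refine inv_anti₀ (by positivity) ?_
  rw [this]
  gcongr
  exacts [key ha y, key hb y]

/-- Extracting the poles at 0 and 1 yields quadratic decay on a vertical line in 0 < Re s < 1, while
the remaining Gamma factors are bounded there. This suffices for integrability. -/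
theorem Gamma_mul_Gamma_one_sub_eq {s : ℂ} (h0 : s ≠ 0) (h1 : s - 1 ≠ 0) :
    Complex.Gamma s * Complex.Gamma (1 - s) =
      (s * (s - 1))⁻¹ * -(Complex.Gamma (s + 1) * Complex.Gamma (2 - s)) := by
  have h2 : 1 - s ≠ 0 := fun h => h1 (by linear_combination -h)
  rw [Complex.Gamma_add_one s h0, show (2 : ℂ) - s = (1 - s) + 1 by ring,
    Complex.Gamma_add_one _ h2]
  field_simp
  ring

theorem integrable_Gamma_mul_Gamma_one_sub {σ : ℝ} (h0 : 0 < σ) (h1 : σ < 1) :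
    Integrable fun y : ℝ => Complex.Gamma (σ + y * Complex.I) *
      Complex.Gamma (1 - (σ + y * Complex.I)) := by
  have hσ : σ - 1 ≠ 0 := by linarith
  have heq : ∀ y : ℝ, ((σ : ℂ) + y * Complex.I) - 1 = ((σ - 1 : ℝ) : ℂ) + y * Complex.I := by
    intro y; push_cast; ring
  have hs : ∀ y : ℝ, Complex.Gamma (σ + y * Complex.I) * Complex.Gamma (1 - (σ + y * Complex.I)) =
      (((σ : ℂ) + y * Complex.I) * (((σ - 1 : ℝ) : ℂ) + y * Complex.I))⁻¹ *
        -(Complex.Gamma (σ + y * Complex.I + 1) * Complex.Gamma (2 - (σ + y * Complex.I))) := by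
    intro y
    rw [Gamma_mul_Gamma_one_sub_eq (vertical_ne_zero h0.ne' y), heq]
    rw [heq]; exact vertical_ne_zero hσ y
  simp only [hs]
  have hr1 : ∀ y : ℝ, ((σ : ℂ) + y * Complex.I + 1).re = σ + 1 := by intro y; simp
  have hr2 : ∀ y : ℝ, (2 - ((σ : ℂ) + y * Complex.I)).re = 2 - σ := by intro y; simp
  refine (integrable_inv_mul_vertical h0.ne' hσ).mul_bdd
    (c := Real.Gamma (σ + 1) * Real.Gamma (2 - σ)) (Continuous.aestronglyMeasurable ?_)
    (ae_of_all _ fun y => ?_)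
  · refine ((Continuous.complexGamma (by fun_prop) fun y => ?_).mul
      (Continuous.complexGamma (by fun_prop) fun y => ?_)).neg
    · rw [hr1]; linarith
    · rw [hr2]; linarith
  · rw [norm_neg, norm_mul]
    have e1 := Complex.norm_Gamma_le_Gamma_re (s := (σ : ℂ) + y * Complex.I + 1) (by rw [hr1]; linarith)
    have e2 := Complex.norm_Gamma_le_Gamma_re (s := 2 - ((σ : ℂ) + y * Complex.I)) (by rw [hr2]; linarith)
    rw [hr1] at e1
    rw [hr2] at e2
    exact mul_le_mul e1 e2 (norm_nonneg _) ((norm_nonneg _).trans e1)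

theorem image_div_one_sub : (fun t : ℝ => t / (1 - t)) '' Ioo 0 1 = Ioi 0 := by
  ext x
  constructor
  · rintro ⟨t, ⟨h0, h1⟩, rfl⟩
    exact div_pos h0 (by linarith)
  · intro hx
    have hx : 0 < x := hx
    refine ⟨x / (1 + x), ⟨by positivity, (div_lt_one (by positivity)).2 (by linarith)⟩, ?_⟩
    field_simp
    ring

theorem injOn_div_one_sub : InjOn (fun t : ℝ => t / (1 - t)) (Ioo 0 1) := by
  intro s hs t ht h
  have h1 : 1 - s ≠ 0 := by linarith [hs.2]
  have h2 : 1 - t ≠ 0 := by linarith [ht.2]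
  simp only at h
  rw [div_eq_div_iff h1 h2] at h
  linarith

theorem hasDerivAt_div_one_sub {t : ℝ} (ht : t ≠ 1) :
    HasDerivAt (fun t : ℝ => t / (1 - t)) (1 / (1 - t) ^ 2) t := by
  have h := (hasDerivAt_id t).div ((hasDerivAt_id t).const_sub 1) (sub_ne_zero.2 ht.symm)
  refine h.congr_deriv ?_
  simp

theorem cpow_div_ofReal {a b : ℝ} (ha : 0 < a) (hb : 0 < b) (s : ℂ) :
    ((a / b : ℝ) : ℂ) ^ s = (a : ℂ) ^ s * (b : ℂ) ^ (-s) := by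
  rw [div_eq_mul_inv, Complex.ofReal_mul, Complex.mul_cpow_ofReal_nonneg ha.le (inv_pos.2 hb).le,
    Complex.ofReal_inv, Complex.inv_cpow _ _ (by
      rw [Complex.arg_ofReal_of_nonneg hb.le]; exact Real.pi_pos.ne), Complex.cpow_neg]

theorem mellin_one_div_one_add_aux {s : ℂ} {t : ℝ} (ht : t ∈ Ioo (0 : ℝ) 1) :
    |1 / (1 - t) ^ 2| • (((t / (1 - t) : ℝ) : ℂ) ^ (s - 1) • (1 / (1 + ((t / (1 - t) : ℝ) : ℂ)))) =
      (t : ℂ) ^ (s - 1) * (1 - t : ℂ) ^ (1 - s - 1) := by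
  obtain ⟨h0, h1⟩ := ht
  have h2 : 0 < 1 - t := by linarith
  have h2' : ((1 - t : ℝ) : ℂ) ≠ 0 := by exact_mod_cast h2.ne'
  rw [cpow_div_ofReal h0 h2, abs_of_pos (by positivity), Complex.real_smul, smul_eq_mul,
    show -(s - 1) = (1 - s - 1) + 1 by ring, Complex.cpow_add _ _ h2', Complex.cpow_one]
  push_cast at h2' ⊢
  field_simp
  ring

/-- The Mellin transform of `1 / (1 + x)`. -/
theorem mellin_one_div_one_add {s : ℂ} (h0 : 0 < s.re) (h1 : s.re < 1) :
    MellinConvergent (fun x : ℝ => 1 / (1 + (x : ℂ))) s ∧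
      mellin (fun x : ℝ => 1 / (1 + (x : ℂ))) s = Complex.Gamma s * Complex.Gamma (1 - s) := by
  have h1' : 0 < (1 - s).re := by simpa using h1
  have hd : ∀ t ∈ Ioo (0 : ℝ) 1,
      HasDerivWithinAt (fun t : ℝ => t / (1 - t)) (1 / (1 - t) ^ 2) (Ioo 0 1) t := fun t ht =>
    (hasDerivAt_div_one_sub ht.2.ne).hasDerivWithinAt
  constructor
  -- The substitution x = t/(1 - t) turns the Mellin integral into the beta integral B(s, 1 - s).
  · rw [MellinConvergent, ← image_div_one_sub,
      integrableOn_image_iff_integrableOn_abs_deriv_smul measurableSet_Ioo hd injOn_div_one_sub]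
    refine IntegrableOn.congr_fun ?_ (fun t ht => (mellin_one_div_one_add_aux ht).symm)
      measurableSet_Ioo
    exact ((intervalIntegrable_iff_integrableOn_Ioo_of_le zero_le_one).1
      (Complex.betaIntegral_convergent h0 h1'))
  · rw [mellin, ← image_div_one_sub,
      integral_image_eq_integral_abs_deriv_smul measurableSet_Ioo hd injOn_div_one_sub,
      setIntegral_congr_fun measurableSet_Ioo fun t ht => mellin_one_div_one_add_aux ht,
      Complex.Gamma_mul_Gamma_eq_betaIntegral h0 h1', add_sub_cancel, Complex.Gamma_one, one_mul,
      Complex.betaIntegral, intervalIntegral.integral_of_le zero_le_one, integral_Ioc_eq_integral_Ioo]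

/-- The Mellin–Barnes integral of `1 / (1 + x)`. -/
theorem one_div_one_add_eq_mellinBarnes {σ : ℝ} (h0 : 0 < σ) (h1 : σ < 1) {x : ℝ} (hx : 0 < x) :
    1 / (1 + (x : ℂ)) = 1 / (2 * Real.pi) * ∫ y : ℝ, Complex.Gamma (σ + y * Complex.I) *
      Complex.Gamma (1 - (σ + y * Complex.I)) * (x : ℂ) ^ (-((σ : ℂ) + y * Complex.I)) := by
  have hm : ∀ y : ℝ, mellin (fun x : ℝ => 1 / (1 + (x : ℂ))) (σ + y * Complex.I) =
      Complex.Gamma (σ + y * Complex.I) * Complex.Gamma (1 - (σ + y * Complex.I)) := fun y =>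
    (mellin_one_div_one_add (by simpa using h0) (by simpa using h1)).2
  have := mellinInv_mellin_eq σ (fun x : ℝ => 1 / (1 + (x : ℂ))) hx
    (mellin_one_div_one_add (by simpa using h0) (by simpa using h1)).1 (by
      rw [Complex.VerticalIntegrable]
      simp only [hm]
      exact integrable_Gamma_mul_Gamma_one_sub h0 h1) (by
      refine ContinuousAt.div continuousAt_const (by fun_prop) ?_
      exact_mod_cast (by positivity : (1 + x) ≠ 0))
  rw [← this, mellinInv]
  simp only [hm, smul_eq_mul, Complex.real_smul]
  push_cast
  simp only [mul_comm]

theorem norm_ofReal_cpow_imaginary {t : ℝ} (ht : 0 < t) (y : ℝ) : ‖(t : ℂ) ^ (-(y * Complex.I))‖ = 1 := by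
  rw [Complex.norm_cpow_eq_rpow_re_of_pos ht]
  simp

/-- The Mellin–Barnes integral of `∫₀¹ (1 - t) ^ v t ^ (-v) r / (1 + r t) dt`. -/
theorem integral_beta_div_one_add {v : ℂ} {d r : ℝ} (hv : 0 < v.re) (h1 : -1 < d) (h2 : d < -v.re)
    (hr : 0 < r) :
    ∫ t in Ioo (0 : ℝ) 1, (t : ℂ) ^ (-v) * (1 - t : ℂ) ^ v * (r / (1 + r * t)) =
      Complex.Gamma (v + 1) * (1 / (2 * Real.pi) * ∫ y : ℝ,
        Complex.Gamma (-v - (d + y * Complex.I)) *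
        (Complex.Gamma (1 + (d + y * Complex.I)) * Complex.Gamma (-(d + y * Complex.I)) /
          Complex.Gamma (1 - (d + y * Complex.I))) * (r : ℂ) ^ (-((d : ℂ) + y * Complex.I))) := by
  set B : ℝ → ℂ := fun y => Complex.Gamma (1 + (d + y * Complex.I)) *
    Complex.Gamma (-(d + y * Complex.I)) * (r : ℂ) ^ (-((d : ℂ) + y * Complex.I)) with hB
  have hrC : (r : ℂ) ≠ 0 := by exact_mod_cast hr.ne'
  have hB' : Integrable B := by
    have h := integrable_Gamma_mul_Gamma_one_sub (σ := d + 1) (by linarith) (by linarith)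
    refine Integrable.mul_bdd (c := r ^ (-d)) ?_
      (FoxParams.continuous_cpow_vertical hr d).aestronglyMeasurable
      (ae_of_all _ fun y => (FoxParams.norm_ofReal_cpow_vertical hr d y).le)
    refine h.congr (ae_of_all _ fun y => ?_)
    simp only
    congr 2 <;> (push_cast; ring)
  -- The factor t^(-1-w), w = d + iy, is split into t^(-1-d), absorbed in `A`, and the unimodular
  -- t^(-iy). The double integrand is then a product of integrable functions times a bounded one,
  -- which justifies Fubini.
  set A : ℝ → ℂ := fun t => (t : ℂ) ^ ((-v - d) - 1) * (1 - t : ℂ) ^ ((v + 1) - 1) with hA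
  have hA' : IntegrableOn A (Ioo 0 1) :=
    (intervalIntegrable_iff_integrableOn_Ioo_of_le zero_le_one).1
      (Complex.betaIntegral_convergent (by simp; linarith) (by simp; linarith))
  have hfun : ∀ t ∈ Ioo (0 : ℝ) 1, (t : ℂ) ^ (-v) * (1 - t : ℂ) ^ v * (r / (1 + r * t)) =
      1 / (2 * Real.pi) * ∫ y : ℝ, A t * B y * (t : ℂ) ^ (-(y * Complex.I)) := by
    intro t ht
    have ht0 : (t : ℂ) ≠ 0 := by exact_mod_cast ht.1.ne'
    -- The Mellin variable is s = 1 + w, and 0 < d + 1 < 1 because d < -Re v < 0.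
    have h := one_div_one_add_eq_mellinBarnes (σ := d + 1) (by linarith) (by linarith)
      (mul_pos hr ht.1)
    push_cast at h
    rw [div_eq_mul_one_div, h]
    rw [mul_left_comm (r : ℂ), mul_left_comm (_ * _), ← integral_const_mul, ← integral_const_mul]
    congr 1
    refine integral_congr_ae (ae_of_all _ fun y => ?_)
    simp only [hA, hB]
    -- Writing s as -(-w + (-1)) lets the powers split as x^(-w) · x^(-1), and r^(-1) cancels the
    -- numerator r.
    rw [Complex.mul_cpow_ofReal_nonneg hr.le ht.1.le,
      show (d : ℂ) + 1 + y * Complex.I = -(-(d + y * Complex.I) + (-1)) by ring, neg_neg,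
      Complex.cpow_add _ _ hrC,
      Complex.cpow_add _ _ ht0,
      show 1 - (-(-((d : ℂ) + y * Complex.I) + -1)) = -(d + y * Complex.I) by ring,
      show -(-((d : ℂ) + y * Complex.I) + -1) = 1 + (d + y * Complex.I) by ring,
      add_sub_cancel_right, Complex.cpow_neg_one r]
    have h4 : (t : ℂ) ^ (-v - d - 1) * (t : ℂ) ^ (-(y * Complex.I)) =
        (t : ℂ) ^ (-v) * ((t : ℂ) ^ (-((d : ℂ) + y * Complex.I)) * (t : ℂ) ^ (-1 : ℂ)) := by
      rw [← Complex.cpow_add _ _ ht0, ← Complex.cpow_add _ _ ht0, ← Complex.cpow_add _ _ ht0]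
      ring_nf
    have h5 : (r : ℂ) * (r : ℂ)⁻¹ = 1 := mul_inv_cancel₀ hrC
    linear_combination (-(1 - t : ℂ) ^ v * (Complex.Gamma (1 + (d + y * Complex.I)) *
      Complex.Gamma (-(d + y * Complex.I)) * (r : ℂ) ^ (-((d : ℂ) + y * Complex.I)))) * h4 +
      ((1 - t : ℂ) ^ v * (Complex.Gamma (1 + (d + y * Complex.I)) *
      Complex.Gamma (-(d + y * Complex.I)) * (r : ℂ) ^ (-((d : ℂ) + y * Complex.I))) *
      (t : ℂ) ^ (-v) * ((t : ℂ) ^ (-((d : ℂ) + y * Complex.I)) * (t : ℂ) ^ (-1 : ℂ))) * h5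
  rw [setIntegral_congr_fun measurableSet_Ioo hfun, integral_const_mul, integral_integral_swap]
  · rw [mul_left_comm]
    congr 1
    rw [← integral_const_mul]
    refine integral_congr_ae (ae_of_all _ fun y => ?_)
    simp only
    have hin : ∀ t ∈ Ioo (0 : ℝ) 1, A t * B y * (t : ℂ) ^ (-(y * Complex.I)) =
        B y * ((t : ℂ) ^ ((-v - (d + y * Complex.I)) - 1) * (1 - t : ℂ) ^ ((v + 1) - 1)) := by
      intro t ht
      have ht0 : (t : ℂ) ≠ 0 := by exact_mod_cast ht.1.ne'
      rw [show -v - (d + y * Complex.I) - 1 = (-v - d - 1) + (-(y * Complex.I)) by ring,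
        Complex.cpow_add _ _ ht0]
      ring
    have hbeta := Complex.Gamma_mul_Gamma_eq_betaIntegral (s := -v - (d + y * Complex.I))
      (t := v + 1) (by simp; linarith) (by simp; linarith)
    rw [Complex.betaIntegral, intervalIntegral.integral_of_le zero_le_one,
      integral_Ioc_eq_integral_Ioo,
      show -v - (d + y * Complex.I) + (v + 1) = 1 - (d + y * Complex.I) by ring] at hbeta
    have hne : Complex.Gamma (1 - (d + y * Complex.I)) ≠ 0 :=
      Complex.Gamma_ne_zero_of_re_pos (by simp; linarith)
    rw [setIntegral_congr_fun measurableSet_Ioo hin, integral_const_mul]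
    simp only [hB]
    field_simp
    linear_combination (-Complex.Gamma (1 + (d + y * Complex.I)) *
      Complex.Gamma (-(d + y * Complex.I)) * (r : ℂ) ^ (-((d : ℂ) + y * Complex.I))) * hbeta
  · refine (Integrable.mul_prod hA' hB').mul_bdd (c := 1)
      (f := fun z : ℝ × ℝ => A z.1 * B z.2) ?_ ?_
    · refine Measurable.aestronglyMeasurable ?_
      fun_prop
    · have : ∀ᵐ x ∂(volume.restrict (Ioo (0 : ℝ) 1)), x ∈ Ioo (0 : ℝ) 1 :=
        ae_restrict_mem measurableSet_Ioo
      filter_upwards [Measure.quasiMeasurePreserving_fst.ae this] with z hz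
      exact (norm_ofReal_cpow_imaginary hz.1 _).le

/-! ### The bivariate H-function as an integral of the tail H-function. -/

section Capacity

variable {p q : ℕ}

theorem capacityParams_separates {P : FoxParams p q} {c d : ℝ}
    (h : (capacityParams P).Separates c d) : -1 < d ∧ d < -c := by
  obtain ⟨-, h1, -, h2, -⟩ := h
  have h1 := h1 0 (by simp [capacityParams])
  have h2 := h2 0 (by simp [capacityParams])
  simp [capacityParams] at h1 h2
  constructor <;> linarith

theorem capacityParams_kernel (P : FoxParams p q) (hn : P.n ≤ p) {v : ℂ} (hv : 0 < v.re) (w : ℂ) :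
    (capacityParams P).kernel v w = P.ccdf.kernel v * Complex.Gamma (v + 1) *
      (Complex.Gamma (-v - w) *
        (Complex.Gamma (1 + w) * Complex.Gamma (-w) / Complex.Gamma (1 - w))) := by
  have hv0 : v ≠ 0 := by rintro rfl; simp at hv
  have h : (capacityParams P).kernel v w = Complex.Gamma (-v - w) * P.shift.kernel v *
      (Complex.Gamma (1 + w) * Complex.Gamma (-w) / Complex.Gamma (1 - w)) := by
    have hQ : (capacityParams P).Q.kernel w =
        Complex.Gamma (1 + w) * Complex.Gamma (-w) / Complex.Gamma (1 - w) := by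
      simp only [FoxParams.kernel, Finset.prod_filter]
      simp [capacityParams, Fin.prod_univ_succ]
    have hR : (capacityParams P).P = P.shift := rfl
    rw [BiFoxParams.kernel, hQ, hR]
    congr 2
    simp only [Finset.prod_filter]
    simp [capacityParams]
  rw [h, FoxParams.shift_kernel, P.ccdf_kernel hn hv, Complex.Gamma_add_one _ hv0]
  field_simp

/-- This displays the quadratic decay in w, with a factor bounded on lines -1 < Re w < 0. -/
theorem Gamma_quotient_eq {w : ℂ} (h0 : w ≠ 0) (h1 : 1 + w ≠ 0) (h2 : 0 < (-w).re) :
    Complex.Gamma (1 + w) * Complex.Gamma (-w) / Complex.Gamma (1 - w) =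
      ((1 + w) * w)⁻¹ * -Complex.Gamma (2 + w) := by
  have h3 := Complex.Gamma_ne_zero_of_re_pos h2
  rw [show 2 + w = (1 + w) + 1 by ring, Complex.Gamma_add_one _ h1,
    show 1 - w = -w + 1 by ring, Complex.Gamma_add_one _ (neg_ne_zero.2 h0)]
  field_simp

theorem integrable_capacityParams_integrand {P : FoxParams p q} (hn : P.n ≤ p) {c d : ℝ}
    (hc : P.ccdf.IsContour c) (hcd : (capacityParams P).Separates c d) {X r : ℝ} (hX : 0 < X)
    (hr : 0 < r) : Integrable ((capacityParams P).integrand c d X r) := by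
  obtain ⟨hc0, -⟩ := FoxParams.ccdf_separates hc.1
  obtain ⟨hd1, hd2⟩ := capacityParams_separates hcd
  have hd : d ≠ 0 := by linarith
  have hd' : 1 + d ≠ 0 := by linarith
  have heq : (capacityParams P).integrand c d X r = fun z : ℝ × ℝ =>
      P.ccdf.kernel (c + z.1 * Complex.I) *
        ((((1 + d : ℝ) : ℂ) + z.2 * Complex.I) * (d + z.2 * Complex.I))⁻¹ *
      (Complex.Gamma ((c + z.1 * Complex.I) + 1) *
        Complex.Gamma (-(c + z.1 * Complex.I) - (d + z.2 * Complex.I)) *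
        -Complex.Gamma (2 + (d + z.2 * Complex.I)) * (X : ℂ) ^ (-((c : ℂ) + z.1 * Complex.I)) *
        (r : ℂ) ^ (-((d : ℂ) + z.2 * Complex.I))) := by
    ext z
    have h1 : ((1 + d : ℝ) : ℂ) + z.2 * Complex.I = 1 + (d + z.2 * Complex.I) := by push_cast; ring
    rw [BiFoxParams.integrand, capacityParams_kernel P hn (by simpa using hc0),
      Gamma_quotient_eq (vertical_ne_zero hd _) (by rw [← h1]; exact vertical_ne_zero hd' _)
        (by simp; linarith), h1]
    ring
  rw [heq]
  have hr1 : ∀ z : ℝ × ℝ, (((c : ℂ) + z.1 * Complex.I) + 1).re = c + 1 := by intro z; simp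
  have hr2 : ∀ z : ℝ × ℝ, (-((c : ℂ) + z.1 * Complex.I) - (d + z.2 * Complex.I)).re = -c - d := by
    intro z; simp
  have hr3 : ∀ z : ℝ × ℝ, (2 + ((d : ℂ) + z.2 * Complex.I)).re = 2 + d := by intro z; simp
  -- The integrand is an integrable function of v times an integrable function of w times bounded
  -- factors. The coupling Γ(-v - w) is among the latter, since its argument has constant real part
  -- -c - d > 0.
  refine (hc.2.mul_prod (integrable_inv_mul_vertical hd' hd)).mul_bdd
    (c := Real.Gamma (c + 1) * Real.Gamma (-c - d) * Real.Gamma (2 + d) * X ^ (-c) * r ^ (-d))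
    (Continuous.aestronglyMeasurable ?_) (ae_of_all _ fun z => ?_)
  · refine ((((Continuous.complexGamma (by fun_prop) fun z => ?_).mul
      (Continuous.complexGamma (by fun_prop) fun z => ?_)).mul
      (Continuous.complexGamma (by fun_prop) fun z => ?_).neg).mul
      ((FoxParams.continuous_cpow_vertical hX c).comp continuous_fst)).mul
      ((FoxParams.continuous_cpow_vertical hr d).comp continuous_snd)
    · rw [hr1]; linarith
    · rw [hr2]; linarith
    · rw [hr3]; linarith
  · have e1 := Complex.norm_Gamma_le_Gamma_re (s := ((c : ℂ) + z.1 * Complex.I) + 1)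
      (by rw [hr1]; linarith)
    have e2 := Complex.norm_Gamma_le_Gamma_re
      (s := -((c : ℂ) + z.1 * Complex.I) - (d + z.2 * Complex.I)) (by rw [hr2]; linarith)
    have e3 := Complex.norm_Gamma_le_Gamma_re (s := 2 + ((d : ℂ) + z.2 * Complex.I))
      (by rw [hr3]; linarith)
    rw [hr1] at e1
    rw [hr2] at e2
    rw [hr3] at e3
    simp only [norm_mul, norm_neg, FoxParams.norm_ofReal_cpow_vertical hX,
      FoxParams.norm_ofReal_cpow_vertical hr]
    have e0 := (norm_nonneg _).trans e1
    gcongr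

/-- The integrand of the double integral of `P.ccdf.foxH c (X t / (1 - t)) r / (1 + r t)`. -/
theorem integrable_ccdf_kernel_mul {P : FoxParams p q} {c : ℝ} (hc : P.ccdf.IsContour c)
    (hc0 : 0 < c) (hc1 : c < 1) {X r : ℝ} (hX : 0 < X) (hr : 0 < r) :
    Integrable (fun z : ℝ × ℝ => P.ccdf.kernel (c + z.2 * Complex.I) *
      (X : ℂ) ^ (-((c : ℂ) + z.2 * Complex.I)) * ((z.1 : ℂ) ^ (-((c : ℂ) + z.2 * Complex.I)) *
        (1 - z.1 : ℂ) ^ ((c : ℂ) + z.2 * Complex.I) * (r / (1 + r * z.1))))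
      ((volume.restrict (Ioo (0 : ℝ) 1)).prod volume) := by
  -- The only singular factor is t^(-c) at 0, which is where c < 1 enters. The factors (1 - t)^v and
  -- r/(1 + r t) are bounded by 1 and r.
  have hA : IntegrableOn (fun t : ℝ => t ^ (-c)) (Ioo 0 1) :=
    (intervalIntegral.integrableOn_Ioo_rpow_iff one_pos).2 (by linarith)
  refine (((Integrable.mul_prod hA hc.2.norm).mul_const (X ^ (-c) * r))).mono' ?_ ?_
  · have h1 : AEStronglyMeasurable (fun z : ℝ × ℝ => P.ccdf.kernel (c + z.2 * Complex.I))
        ((volume.restrict (Ioo (0 : ℝ) 1)).prod volume) := hc.2.1.comp_snd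
    have h2 : Measurable fun z : ℝ × ℝ => (X : ℂ) ^ (-((c : ℂ) + z.2 * Complex.I)) := by fun_prop
    have h3 : Measurable fun z : ℝ × ℝ => ((z.1 : ℂ) ^ (-((c : ℂ) + z.2 * Complex.I)) *
        (1 - z.1 : ℂ) ^ ((c : ℂ) + z.2 * Complex.I) * (r / (1 + r * z.1))) := by fun_prop
    exact (h1.mul h2.aestronglyMeasurable).mul h3.aestronglyMeasurable
  · have : ∀ᵐ x ∂(volume.restrict (Ioo (0 : ℝ) 1)), x ∈ Ioo (0 : ℝ) 1 :=
      ae_restrict_mem measurableSet_Ioo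
    filter_upwards [Measure.quasiMeasurePreserving_fst.ae this] with z hz
    have ht1 : 0 < 1 - z.1 := by linarith [hz.2]
    have hz0 := hz.1
    have e1 : ‖(1 - z.1 : ℂ) ^ ((c : ℂ) + z.2 * Complex.I)‖ ≤ 1 := by
      have := Complex.norm_cpow_eq_rpow_re_of_pos ht1 ((c : ℂ) + z.2 * Complex.I)
      push_cast at this
      rw [this]
      exact Real.rpow_le_one ht1.le (by linarith) (by simpa using hc0.le)
    have e2 : ‖(r / (1 + r * z.1) : ℂ)‖ ≤ r := by
      have : (r / (1 + r * z.1) : ℂ) = ((r / (1 + r * z.1) : ℝ) : ℂ) := by push_cast; rfl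
      rw [this, Complex.norm_real, Real.norm_of_nonneg (by positivity)]
      refine div_le_self hr.le ?_
      have := mul_pos hr hz0
      linarith
    simp only [norm_mul, FoxParams.norm_ofReal_cpow_vertical hX,
      FoxParams.norm_ofReal_cpow_vertical hz0]
    have hXc : 0 < X ^ (-c) := Real.rpow_pos_of_pos hX _
    have hzc : 0 < z.1 ^ (-c) := Real.rpow_pos_of_pos hz0 _
    calc _ ≤ ‖P.ccdf.kernel (c + z.2 * Complex.I)‖ * X ^ (-c) * (z.1 ^ (-c) * 1 * r) := by gcongr
      _ = _ := by ring

theorem ccdf_foxH_mul_eq {P : FoxParams p q} {c X r t : ℝ} (hX : 0 < X) (ht : t ∈ Ioo (0 : ℝ) 1) :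
    P.ccdf.foxH c (X * (t / (1 - t))) * (r / (1 + r * t)) = 1 / (2 * Real.pi) *
      ∫ y : ℝ, P.ccdf.kernel (c + y * Complex.I) *
      (X : ℂ) ^ (-((c : ℂ) + y * Complex.I)) * ((t : ℂ) ^ (-((c : ℂ) + y * Complex.I)) *
        (1 - t : ℂ) ^ ((c : ℂ) + y * Complex.I) * (r / (1 + r * t))) := by
  have ht1 : 0 < 1 - t := by linarith [ht.2]
  rw [FoxParams.foxH, mul_assoc, ← integral_mul_const]
  congr 1
  refine integral_congr_ae (ae_of_all _ fun y => ?_)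
  simp only
  rw [Complex.ofReal_mul, Complex.mul_cpow_ofReal_nonneg hX.le (div_pos ht.1 ht1).le,
    cpow_div_ofReal ht.1 ht1, neg_neg]
  push_cast
  ring

theorem integrableOn_ccdf_foxH_mul {P : FoxParams p q} {c : ℝ} (hc : P.ccdf.IsContour c)
    (hc0 : 0 < c) (hc1 : c < 1) {X r : ℝ} (hX : 0 < X) (hr : 0 < r) :
    IntegrableOn (fun t : ℝ => P.ccdf.foxH c (X * (t / (1 - t))) * (r / (1 + r * t) : ℂ))
      (Ioo 0 1) :=
  ((integrable_ccdf_kernel_mul hc hc0 hc1 hX hr).integral_prod_left.const_mul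
    (1 / (2 * Real.pi) : ℂ)).congr (by
      filter_upwards [ae_restrict_mem measurableSet_Ioo] with t ht
      exact (ccdf_foxH_mul_eq hX ht).symm)

theorem integral_ccdf_foxH_mul {P : FoxParams p q} (hn : P.n ≤ p) {c d : ℝ}
    (hc : P.ccdf.IsContour c) (hcd : (capacityParams P).Separates c d) {X r : ℝ} (hX : 0 < X)
    (hr : 0 < r) :
    ∫ t in Ioo (0 : ℝ) 1, P.ccdf.foxH c (X * (t / (1 - t))) * (r / (1 + r * t) : ℂ) =
      (capacityParams P).foxH c d X r := by
  obtain ⟨hc0, -⟩ := FoxParams.ccdf_separates hc.1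
  obtain ⟨hd1, hd2⟩ := capacityParams_separates hcd
  rw [setIntegral_congr_fun measurableSet_Ioo fun t ht => ccdf_foxH_mul_eq hX ht,
    integral_const_mul,
    integral_integral_swap (integrable_ccdf_kernel_mul hc hc0 (by linarith) hX hr),
    BiFoxParams.foxH, Measure.volume_eq_prod,
    integral_prod _ (integrable_capacityParams_integrand hn hc hcd hX hr),
    pow_two, one_div_mul_eq_div, ← one_div_mul_one_div, mul_assoc, div_eq_mul_one_div,
    mul_comm _ (1 / (2 * (Real.pi : ℂ)))]
  congr 1
  rw [← integral_const_mul]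
  refine integral_congr_ae (ae_of_all _ fun y => ?_)
  simp only
  rw [integral_const_mul, integral_beta_div_one_add (by simpa using hc0) hd1 (by simpa using hd2) hr]
  simp only [BiFoxParams.integrand, capacityParams_kernel P hn
    (show 0 < ((c : ℂ) + y * Complex.I).re by simpa using hc0)]
  rw [← mul_assoc, mul_left_comm, ← integral_const_mul]
  congr 1
  refine integral_congr_ae (ae_of_all _ fun x => ?_)
  simp only
  ring

theorem integrable_and_integral_ccdf_foxH_div {P : FoxParams p q} (hn : P.n ≤ p) {c d : ℝ}
    (hc : P.ccdf.IsContour c) (hcd : (capacityParams P).Separates c d) {X r : ℝ} (hX : 0 < X)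
    (hr : 0 < r) :
    IntervalIntegrable (fun x : ℝ => P.ccdf.foxH c (X * (x / (r - x))) / (1 + x : ℂ)) volume 0 r ∧
    ∫ x in (0 : ℝ)..r, P.ccdf.foxH c (X * (x / (r - x))) / (1 + x : ℂ) =
      (capacityParams P).foxH c d X r := by
  obtain ⟨hc0, -⟩ := FoxParams.ccdf_separates hc.1
  obtain ⟨hd1, hd2⟩ := capacityParams_separates hcd
  have hrC : (r : ℂ) ≠ 0 := by exact_mod_cast hr.ne'
  -- Under x = r t the ratio x/(r - x) becomes t/(1 - t).
  have heq : ∀ t : ℝ, P.ccdf.foxH c (X * (t / (1 - t))) * (r / (1 + r * t) : ℂ) =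
      r * (P.ccdf.foxH c (X * (r * t / (r - r * t))) / (1 + (r * t : ℝ) : ℂ)) := by
    intro t
    rw [show r - r * t = r * (1 - t) by ring, mul_div_mul_left _ _ hr.ne']
    push_cast
    ring
  have hI := integrableOn_ccdf_foxH_mul hc hc0 (by linarith) hX hr
  have hV := integral_ccdf_foxH_mul hn hc hcd hX hr
  simp only [heq] at hI hV
  constructor
  · have h1 := (intervalIntegrable_iff_integrableOn_Ioo_of_le zero_le_one).2 hI
    have h2 := h1.const_mul (r : ℂ)⁻¹
    simp only [inv_mul_cancel_left₀ hrC] at h2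
    have h3 := h2.comp_mul_left (c := r⁻¹)
    simpa [mul_inv_cancel_left₀ hr.ne'] using h3
  · rw [← integral_Ioc_eq_integral_Ioo, ← intervalIntegral.integral_of_le zero_le_one,
      intervalIntegral.integral_const_mul] at hV
    rw [← hV]
    have h := intervalIntegral.smul_integral_comp_mul_left
      (f := fun x : ℝ => P.ccdf.foxH c (X * (x / (r - x))) / (1 + x : ℂ)) (a := 0) (b := 1) r
    rw [mul_zero, mul_one, Complex.real_smul] at h
    exact h.symm

end Capacity

/-! ### Laws on (0, ∞) with a density. -/

section Law

variable {Ω : Type*} [MeasurableSpace Ω] {μ : Measure Ω} {X : Ω → ℝ}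
  {f : ℝ → ℝ}

theorem integrableOn_of_map_eq_withDensity [IsProbabilityMeasure μ]
    (hX : AEMeasurable X μ) (hf0 : ∀ x, 0 < x → 0 ≤ f x)
    (hfc : ContinuousOn f (Ioi 0))
    (hlaw : μ.map X = (volume.restrict (Ioi (0 : ℝ))).withDensity fun x => ENNReal.ofReal (f x)) :
    IntegrableOn f (Ioi 0) := by
  have : IsProbabilityMeasure (μ.map X) := Measure.isProbabilityMeasure_map hX
  have h0 : 0 ≤ᵐ[volume.restrict (Ioi (0 : ℝ))] f :=
    (ae_restrict_mem measurableSet_Ioi).mono fun x hx => hf0 x hx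
  refine (lintegral_ofReal_ne_top_iff_integrable (hfc.aestronglyMeasurable measurableSet_Ioi) h0).1 ?_
  have h := measure_univ (μ := μ.map X)
  rw [hlaw, withDensity_apply _ MeasurableSet.univ, Measure.restrict_univ] at h
  rw [h]
  exact ENNReal.one_ne_top

theorem measureReal_preimage_of_map_eq_withDensity (hX : AEMeasurable X μ)
    (hf0 : ∀ x, 0 < x → 0 ≤ f x) (hfi : IntegrableOn f (Ioi 0))
    (hlaw : μ.map X = (volume.restrict (Ioi (0 : ℝ))).withDensity fun x => ENNReal.ofReal (f x))
    {S : Set ℝ} (hS : MeasurableSet S) :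
    μ.real (X ⁻¹' S) = ∫ x in S ∩ Ioi 0, f x := by
  have h0 : 0 ≤ᵐ[volume.restrict (S ∩ Ioi (0 : ℝ))] f :=
    (ae_restrict_mem (hS.inter measurableSet_Ioi)).mono fun x hx => hf0 x hx.2
  rw [integral_eq_lintegral_of_nonneg_ae h0 (hfi.mono_set inter_subset_right).1, measureReal_def,
    ← Measure.map_apply_of_aemeasurable hX hS, hlaw, withDensity_apply _ hS,
    Measure.restrict_restrict hS]

theorem integral_Ioi_eq_one_of_map_eq_withDensity [IsProbabilityMeasure μ]
    (hX : AEMeasurable X μ)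
    (hf0 : ∀ x, 0 < x → 0 ≤ f x) (hfi : IntegrableOn f (Ioi 0))
    (hlaw : μ.map X = (volume.restrict (Ioi (0 : ℝ))).withDensity fun x => ENNReal.ofReal (f x)) :
    ∫ x in Ioi (0 : ℝ), f x = 1 := by
  have := measureReal_preimage_of_map_eq_withDensity hX hf0 hfi hlaw MeasurableSet.univ
  rw [preimage_univ, univ_inter, probReal_univ] at this
  exact this.symm

theorem ae_pos_of_map_eq_withDensity (hX : AEMeasurable X μ)
    (hlaw : μ.map X = (volume.restrict (Ioi (0 : ℝ))).withDensity fun x => ENNReal.ofReal (f x)) :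
    ∀ᵐ o ∂μ, 0 < X o := by
  refine ae_of_ae_map hX (p := fun x => 0 < x) ?_
  rw [hlaw]
  exact (withDensity_absolutelyContinuous _ _).ae_le (ae_restrict_mem measurableSet_Ioi)

/-- The distribution function of a law on `(0, ∞)` with density `f`, as a primitive. -/
theorem distribFun_eq_integral (hX : AEMeasurable X μ) (hf0 : ∀ x, 0 < x → 0 ≤ f x)
    (hfi : IntegrableOn f (Ioi 0))
    (hlaw : μ.map X = (volume.restrict (Ioi (0 : ℝ))).withDensity fun x => ENNReal.ofReal (f x))
    {y : ℝ} (hy : 0 ≤ y) :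
    distribFun μ X y = ∫ u in (0 : ℝ)..y, (Ioi 0).indicator f u := by
  have h := measureReal_preimage_of_map_eq_withDensity hX hf0 hfi hlaw
    (measurableSet_Iic (a := y))
  rw [distribFun, intervalIntegral.integral_of_le hy, setIntegral_indicator measurableSet_Ioi]
  refine h.trans ?_
  congr 2
  ext x
  simp only [mem_inter_iff, mem_Iic, mem_Ioi, mem_Ioc]
  tauto

end Law

/-! ### The distribution function of the SINR and integration by parts. -/

theorem sinr_le_iff {ω ϱ τ γ x : ℝ} (hϱ : 0 < ϱ) (hτ : 0 < τ) (hγ : 0 < γ) (hx : x < ω / ϱ) :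
    sinr ω ϱ τ γ ≤ x ↔ γ ≤ τ / ϱ * (x / (ω / ϱ - x)) := by
  have h1 : 0 < ω - ϱ * x := by
    rw [lt_div_iff₀ hϱ] at hx; linarith
  have h2 : τ / ϱ * (x / (ω / ϱ - x)) = τ * x / (ω - ϱ * x) := by
    have : ω / ϱ - x = (ω - ϱ * x) / ϱ := by field_simp
    rw [this]
    field_simp
  have h3 : ω / (ϱ + τ / γ) = ω * γ / (ϱ * γ + τ) := by field_simp
  rw [sinr, h2, h3, div_le_iff₀ (by positivity), le_div_iff₀ h1]
  constructor <;> intro h <;> linarith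

theorem sinr_lt {ω ϱ τ γ : ℝ} (hω : 0 < ω) (hϱ : 0 < ϱ) (hτ : 0 < τ) (hγ : 0 < γ) :
    sinr ω ϱ τ γ < ω / ϱ := by
  rw [sinr]
  have : 0 < τ / γ := by positivity
  gcongr
  linarith

section Distribution

variable {Ω : Type*} [MeasurableSpace Ω] {μ : Measure Ω} {X : Ω → ℝ}
  {f : ℝ → ℝ} {ω ϱ τ : ℝ}

theorem distribFun_sinr (hϱ : 0 < ϱ) (hτ : 0 < τ) (hX : ∀ᵐ o ∂μ, 0 < X o) {x : ℝ}
    (hx : x < ω / ϱ) :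
    distribFun μ (fun o => sinr ω ϱ τ (X o)) x = distribFun μ X (τ / ϱ * (x / (ω / ϱ - x))) := by
  refine measureReal_congr ?_
  filter_upwards [hX] with o ho
  exact propext (sinr_le_iff hϱ hτ ho hx)

theorem distribFun_sinr_top [IsProbabilityMeasure μ] (hω : 0 < ω) (hϱ : 0 < ϱ) (hτ : 0 < τ) (hX : ∀ᵐ o ∂μ, 0 < X o) :
    distribFun μ (fun o => sinr ω ϱ τ (X o)) (ω / ϱ) = 1 := by
  rw [distribFun, ← probReal_univ (μ := μ)]
  refine measureReal_congr ?_
  filter_upwards [hX] with o ho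
  exact propext ⟨fun _ => trivial, fun _ => (sinr_lt hω hϱ hτ ho).le⟩

theorem hasDerivAt_div_sub {r x : ℝ} (hx : x ≠ r) (k : ℝ) :
    HasDerivAt (fun x : ℝ => k * (x / (r - x))) (k * (r / (r - x) ^ 2)) x := by
  have h := ((hasDerivAt_id x).div ((hasDerivAt_id x).const_sub r)
    (sub_ne_zero.2 hx.symm)).const_mul k
  refine h.congr_deriv ?_
  simp

theorem hasDerivAt_distribFun_sinr [IsProbabilityMeasure μ] (hϱ : 0 < ϱ) (hτ : 0 < τ) (hX : AEMeasurable X μ)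
    (hf0 : ∀ x, 0 < x → 0 ≤ f x) (hfc : ContinuousOn f (Ioi 0))
    (hlaw : μ.map X = (volume.restrict (Ioi (0 : ℝ))).withDensity fun x => ENNReal.ofReal (f x))
    {x : ℝ} (hx : x ∈ Ioo 0 (ω / ϱ)) :
    HasDerivAt (distribFun μ fun o => sinr ω ϱ τ (X o))
      (f (τ / ϱ * (x / (ω / ϱ - x))) * (τ / ϱ * (ω / ϱ / (ω / ϱ - x) ^ 2))) x := by
  have hfi := integrableOn_of_map_eq_withDensity hX hf0 hfc hlaw
  have hpos := ae_pos_of_map_eq_withDensity hX hlaw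
  have hg0 : ∀ {x}, x ∈ Ioo 0 (ω / ϱ) → 0 < τ / ϱ * (x / (ω / ϱ - x)) := fun {x} hx =>
    mul_pos (by positivity) (div_pos hx.1 (by linarith [hx.2]))
  have hI : Integrable ((Ioi 0).indicator f) := (integrable_indicator_iff measurableSet_Ioi).2 hfi
  set y := τ / ϱ * (x / (ω / ϱ - x)) with hy
  have hev : (Ioi 0).indicator f =ᶠ[𝓝 y] f := by
    filter_upwards [lt_mem_nhds (hg0 hx)] with u hu
    exact indicator_of_mem (s := Ioi 0) hu f
  have hcont : ContinuousAt ((Ioi 0).indicator f) y :=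
    (hfc.continuousAt (Ioi_mem_nhds (hg0 hx))).congr hev.symm
  have hG : HasDerivAt (fun u => ∫ t in (0 : ℝ)..u, (Ioi 0).indicator f t) (f y) y := by
    have := intervalIntegral.integral_hasDerivAt_right (hI.intervalIntegrable (a := 0) (b := y))
      ⟨univ, univ_mem, by simpa using hI.1⟩ hcont
    rwa [hev.eq_of_nhds] at this
  refine (hG.comp x (hasDerivAt_div_sub hx.2.ne (τ / ϱ))).congr_of_eventuallyEq ?_
  filter_upwards [Ioo_mem_nhds hx.1 hx.2] with u hu
  rw [distribFun_sinr hϱ hτ hpos hu.2, distribFun_eq_integral hX hf0 hfi hlaw (hg0 hu).le]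
  rfl

theorem continuousOn_distribFun_sinr [IsProbabilityMeasure μ]
    (hω : 0 < ω) (hϱ : 0 < ϱ) (hτ : 0 < τ) (hX : AEMeasurable X μ)
    (hf0 : ∀ x, 0 < x → 0 ≤ f x) (hfc : ContinuousOn f (Ioi 0))
    (hlaw : μ.map X = (volume.restrict (Ioi (0 : ℝ))).withDensity fun x => ENNReal.ofReal (f x)) :
    ContinuousOn (distribFun μ fun o => sinr ω ϱ τ (X o)) (Icc 0 (ω / ϱ)) := by
  have hfi := integrableOn_of_map_eq_withDensity hX hf0 hfc hlaw
  have hpos := ae_pos_of_map_eq_withDensity hX hlaw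
  have hI : Integrable ((Ioi 0).indicator f) := (integrable_indicator_iff measurableSet_Ioi).2 hfi
  have hr : 0 < ω / ϱ := by positivity
  have heq : ∀ x ∈ Ico 0 (ω / ϱ), distribFun μ (fun o => sinr ω ϱ τ (X o)) x =
      ∫ t in (0 : ℝ)..(τ / ϱ * (x / (ω / ϱ - x))), (Ioi 0).indicator f t := fun x hx => by
    rw [distribFun_sinr hϱ hτ hpos hx.2, distribFun_eq_integral hX hf0 hfi hlaw
      (mul_nonneg (by positivity) (div_nonneg hx.1 (by linarith [hx.2])))]
  intro x hx
  rcases hx.2.eq_or_lt with rfl | hlt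
  · refine ContinuousWithinAt.mono (t := Iic (ω / ϱ)) ?_ fun u hu => hu.2
    rw [← continuousWithinAt_Iio_iff_Iic, ContinuousWithinAt, distribFun_sinr_top hω hϱ hτ hpos,
      ← integral_Ioi_eq_one_of_map_eq_withDensity hX hf0 hfi hlaw]
    -- As x approaches ω/ϱ from the left the SNR threshold tends to ∞, so the primitive tends to the
    -- total mass 1, which is the value at the endpoint.
    have hlim : Tendsto (fun x => τ / ϱ * (x / (ω / ϱ - x))) (𝓝[<] (ω / ϱ)) atTop := by
      refine Tendsto.const_mul_atTop (by positivity) ?_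
      simp only [div_eq_mul_inv _ (_ - _)]
      refine Tendsto.pos_mul_atTop hr (tendsto_id.mono_left nhdsWithin_le_nhds) ?_
      refine tendsto_inv_nhdsGT_zero.comp (tendsto_nhdsWithin_iff.2 ⟨?_, ?_⟩)
      · have : Tendsto (fun x => ω / ϱ - x) (𝓝 (ω / ϱ)) (𝓝 (ω / ϱ - ω / ϱ)) :=
          tendsto_const_nhds.sub tendsto_id
        rw [sub_self] at this
        exact this.mono_left nhdsWithin_le_nhds
      · filter_upwards [self_mem_nhdsWithin] with u hu
        exact sub_pos.2 (show u < ω / ϱ from hu)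
    have h1 := intervalIntegral_tendsto_integral_Ioi 0 hI.integrableOn hlim
    rw [setIntegral_indicator measurableSet_Ioi, inter_self] at h1
    refine h1.congr' ?_
    filter_upwards [Ioo_mem_nhdsLT hr] with u hu
    exact (heq u ⟨hu.1.le, hu.2⟩).symm
  · have hc : ContinuousAt (fun x => ∫ t in (0 : ℝ)..(τ / ϱ * (x / (ω / ϱ - x))),
        (Ioi 0).indicator f t) x :=
      (hI.continuous_primitive 0).continuousAt.comp
        (f := fun x => τ / ϱ * (x / (ω / ϱ - x))) (hasDerivAt_div_sub hlt.ne _).continuousAt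
    refine hc.continuousWithinAt.congr_of_eventuallyEq ?_ (heq x ⟨hx.1, hlt⟩)
    filter_upwards [self_mem_nhdsWithin, mem_nhdsWithin_of_mem_nhds (Iio_mem_nhds hlt)] with u hu hu'
    exact heq u ⟨hu.1, hu'⟩

/-- A nonnegative derivative of a function continuous on the closed interval is integrable, so no
estimate of the density at 0 or ∞ is needed. -/
theorem intervalIntegrable_deriv_distribFun_sinr [IsProbabilityMeasure μ]
    (hω : 0 < ω) (hϱ : 0 < ϱ) (hτ : 0 < τ) (hX : AEMeasurable X μ)
    (hf0 : ∀ x, 0 < x → 0 ≤ f x) (hfc : ContinuousOn f (Ioi 0))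
    (hlaw : μ.map X = (volume.restrict (Ioi (0 : ℝ))).withDensity fun x => ENNReal.ofReal (f x)) :
    IntervalIntegrable (deriv (distribFun μ fun o => sinr ω ϱ τ (X o))) volume 0 (ω / ϱ) := by
  have hr : 0 < ω / ϱ := by positivity
  refine intervalIntegral.intervalIntegrable_deriv_of_nonneg
    (g := distribFun μ fun o => sinr ω ϱ τ (X o)) ?_ ?_ ?_
  · rw [uIcc_of_le hr.le]
    exact continuousOn_distribFun_sinr hω hϱ hτ hX hf0 hfc hlaw
  · rw [min_eq_left hr.le, max_eq_right hr.le]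
    intro x hx
    exact (hasDerivAt_distribFun_sinr hϱ hτ hX hf0 hfc hlaw hx).differentiableAt.hasDerivAt
  · rw [min_eq_left hr.le, max_eq_right hr.le]
    intro x hx
    rw [(hasDerivAt_distribFun_sinr hϱ hτ hX hf0 hfc hlaw hx).deriv]
    have h1 : 0 < ω / ϱ - x := by linarith [hx.2]
    have := hf0 (τ / ϱ * (x / (ω / ϱ - x))) (mul_pos (by positivity) (div_pos hx.1 h1))
    positivity

theorem integral_log_mul_deriv_distribFun_sinr [IsProbabilityMeasure μ]
    (hω : 0 < ω) (hϱ : 0 < ϱ) (hτ : 0 < τ) (hX : AEMeasurable X μ)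
    (hf0 : ∀ x, 0 < x → 0 ≤ f x) (hfc : ContinuousOn f (Ioi 0))
    (hlaw : μ.map X = (volume.restrict (Ioi (0 : ℝ))).withDensity fun x => ENNReal.ofReal (f x)) :
    IntervalIntegrable (fun x => Real.log (1 + x) *
      deriv (distribFun μ fun o => sinr ω ϱ τ (X o)) x) volume 0 (ω / ϱ) ∧
    ∫ x in (0 : ℝ)..(ω / ϱ), Real.log (1 + x) *
      deriv (distribFun μ fun o => sinr ω ϱ τ (X o)) x =
    ∫ x in (0 : ℝ)..(ω / ϱ), (1 - distribFun μ X (τ / ϱ * (x / (ω / ϱ - x)))) / (1 + x) := by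
  have hr : 0 < ω / ϱ := by positivity
  have hpos := ae_pos_of_map_eq_withDensity hX hlaw
  have hd := intervalIntegrable_deriv_distribFun_sinr hω hϱ hτ hX hf0 hfc hlaw
  have hne : ∀ x ∈ uIcc 0 (ω / ϱ), 1 + x ≠ 0 := fun x hx => by
    rw [uIcc_of_le hr.le] at hx
    linarith [hx.1]
  have hlog : ContinuousOn (fun x => Real.log (1 + x)) (uIcc 0 (ω / ϱ)) :=
    ContinuousOn.log (by fun_prop) hne
  refine ⟨hd.continuousOn_mul hlog, ?_⟩
  have hparts := intervalIntegral.integral_mul_deriv_eq_deriv_mul_of_hasDerivAt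
    (u := fun x => Real.log (1 + x)) (u' := fun x => 1 / (1 + x))
    -- The constant -1 makes the boundary term vanish at ω/ϱ; log 1 = 0 does so at 0.
    (v := fun x => distribFun μ (fun o => sinr ω ϱ τ (X o)) x - 1)
    (v' := deriv (distribFun μ fun o => sinr ω ϱ τ (X o))) hlog
    (by
      rw [uIcc_of_le hr.le]
      exact (continuousOn_distribFun_sinr hω hϱ hτ hX hf0 hfc hlaw).sub continuousOn_const)
    (fun x hx => by
      rw [min_eq_left hr.le, max_eq_right hr.le] at hx
      exact ((hasDerivAt_id x).const_add 1).log (by have := hx.1; simp only [id]; linarith))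
    (fun x hx => by
      rw [min_eq_left hr.le, max_eq_right hr.le] at hx
      exact ((hasDerivAt_distribFun_sinr hϱ hτ hX hf0 hfc
        hlaw hx).differentiableAt.hasDerivAt).sub_const 1)
    (ContinuousOn.intervalIntegrable (continuousOn_const.div (by fun_prop) hne)) hd
  rw [hparts, distribFun_sinr_top hω hϱ hτ hpos]
  simp only [sub_self, mul_zero, add_zero, Real.log_one, zero_mul, zero_sub]
  rw [← intervalIntegral.integral_neg, intervalIntegral.integral_of_le hr.le,
    intervalIntegral.integral_of_le hr.le, integral_Ioc_eq_integral_Ioo,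
    integral_Ioc_eq_integral_Ioo]
  refine setIntegral_congr_fun measurableSet_Ioo fun x hx => ?_
  rw [distribFun_sinr hϱ hτ hpos hx.2]
  ring

end Distribution

/-! ### The tail of the SNR as a combination of H-functions. -/

theorem FoxParams.tendsto_foxH_atTop {p q : ℕ} (P : FoxParams p q) {c k : ℝ} (hc : 0 < c)
    (hk : 0 < k) : Tendsto (fun x => P.foxH c (k * x)) atTop (𝓝 0) := by
  have h := ((tendsto_rpow_neg_atTop hc).comp (tendsto_id.const_mul_atTop hk)).const_mul
    (1 / (2 * Real.pi) * (∫ y : ℝ, ‖P.kernel (c + y * Complex.I)‖))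
  rw [mul_zero] at h
  refine squeeze_zero_norm' ?_ h
  filter_upwards [eventually_gt_atTop 0] with x hx
  exact P.norm_foxH_le c (by simpa using mul_pos hk hx)

section Density

variable {Ω : Type*} [MeasurableSpace Ω] {μ : Measure Ω} [IsProbabilityMeasure μ] {X : Ω → ℝ}
  {f : ℝ → ℝ} {L p q : ℕ} {P : Fin L → FoxParams p q} {ψ φ σ c : Fin L → ℝ}

theorem continuousOn_of_eq_sum_foxH (hφ : ∀ l, 0 < φ l) (hσ : ∀ l, (P l).IsContour (σ l))
    (hf : ∀ x, 0 < x → (f x : ℂ) = ∑ l, (ψ l : ℂ) * (P l).foxH (σ l) (φ l * x)) :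
    ContinuousOn f (Ioi 0) := by
  have h1 : ContinuousOn (fun x => ∑ l, (ψ l : ℂ) * (P l).foxH (σ l) (φ l * x)) (Ioi 0) := by
    refine continuousOn_finsetSum _ fun l _ => continuousOn_const.mul fun x hx => ?_
    exact ((FoxParams.continuousAt_foxH (hσ l).2 (mul_pos (hφ l) hx)).comp
      (f := fun x => φ l * x) (by fun_prop)).continuousWithinAt
  refine (Complex.continuous_re.comp_continuousOn h1).congr fun x hx => ?_
  simp only [Function.comp_apply, ← hf x hx, Complex.ofReal_re]

/-- The complementary distribution function of a law whose density is a combination of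
H-functions. -/
theorem one_sub_distribFun_eq_sum_foxH (hn : ∀ l, (P l).n ≤ p) (hφ : ∀ l, 0 < φ l)
    (hσ : ∀ l, (P l).IsContour (σ l)) (hc : ∀ l, (P l).ccdf.IsContour (c l))
    (hf : ∀ x, 0 < x → (f x : ℂ) = ∑ l, (ψ l : ℂ) * (P l).foxH (σ l) (φ l * x))
    (hX : AEMeasurable X μ) (hf0 : ∀ x, 0 < x → 0 ≤ f x)
    (hlaw : μ.map X = (volume.restrict (Ioi (0 : ℝ))).withDensity fun x => ENNReal.ofReal (f x))
    {y : ℝ} (hy : 0 < y) :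
    ((1 - distribFun μ X y : ℝ) : ℂ) =
      ∑ l, (ψ l : ℂ) / (φ l : ℂ) * (P l).ccdf.foxH (c l) (φ l * y) := by
  have hfc := continuousOn_of_eq_sum_foxH hφ hσ hf
  have hfi := integrableOn_of_map_eq_withDensity hX hf0 hfc hlaw
  have hI : Integrable ((Ioi 0).indicator f) := (integrable_indicator_iff measurableSet_Ioi).2 hfi
  have hlim1 : Tendsto (fun b : ℝ => ((distribFun μ X b - distribFun μ X y : ℝ) : ℂ)) atTop
      (𝓝 ((1 - distribFun μ X y : ℝ) : ℂ)) := by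
    refine (Complex.continuous_ofReal.tendsto _).comp (Tendsto.sub_const ?_ _)
    have h1 := intervalIntegral_tendsto_integral_Ioi 0 hI.integrableOn tendsto_id
    rw [setIntegral_indicator measurableSet_Ioi, inter_self,
      integral_Ioi_eq_one_of_map_eq_withDensity hX hf0 hfi hlaw] at h1
    refine h1.congr' ?_
    filter_upwards [eventually_ge_atTop 0] with b hb
    exact (distribFun_eq_integral hX hf0 hfi hlaw hb).symm
  have hlim2 : Tendsto (fun b : ℝ => ∑ l, (ψ l : ℂ) / (φ l : ℂ) *
      ((P l).ccdf.foxH (c l) (φ l * y) - (P l).ccdf.foxH (c l) (φ l * b))) atTop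
      (𝓝 (∑ l, (ψ l : ℂ) / (φ l : ℂ) * ((P l).ccdf.foxH (c l) (φ l * y) - 0))) :=
    tendsto_finsetSum _ fun l _ => (tendsto_const_nhds.sub
      ((P l).ccdf.tendsto_foxH_atTop (FoxParams.ccdf_separates (hc l).1).1 (hφ l))).const_mul _
  simp only [sub_zero] at hlim2
  -- The mass of (y, b] is computed in two ways and b → ∞. Termwise integration is thus needed on
  -- compact intervals only.
  refine tendsto_nhds_unique (hlim1.congr' ?_) hlim2
  filter_upwards [eventually_ge_atTop y] with b hb
  have hsub : Icc y b ⊆ Ioi 0 := fun x hx => hy.trans_le hx.1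
  rw [distribFun_eq_integral hX hf0 hfi hlaw (hy.le.trans hb),
    distribFun_eq_integral hX hf0 hfi hlaw hy.le,
    intervalIntegral.integral_interval_sub_left hI.intervalIntegrable hI.intervalIntegrable,
    ← intervalIntegral.integral_ofReal,
    intervalIntegral.integral_congr (g := fun x => ∑ l, (ψ l : ℂ) * (P l).foxH (σ l) (φ l * x))]
  · rw [intervalIntegral.integral_finsetSum]
    · refine Finset.sum_congr rfl fun l _ => ?_
      rw [intervalIntegral.integral_const_mul,
        FoxParams.intervalIntegral_foxH_scaled (hn l) (hσ l) (hc l) (hφ l) hy hb]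
      ring
    · intro l _
      refine (ContinuousOn.intervalIntegrable fun x hx => ?_).const_mul _
      rw [uIcc_of_le hb] at hx
      exact ((FoxParams.continuousAt_foxH (hσ l).2 (mul_pos (hφ l) (hsub hx))).comp
        (f := fun x => φ l * x) (by fun_prop)).continuousWithinAt
  · intro x hx
    rw [uIcc_of_le hb] at hx
    simp only
    rw [indicator_of_mem (hsub hx), hf x (hsub hx)]

end Density

end

/-! ### The capacity formula. -/

theorem proposition1 {Ω : Type*} [MeasurableSpace Ω] (μ : Measure Ω) [IsProbabilityMeasure μ]
    {L m n p q : ℕ} (hm : m ≤ q) (hn : n ≤ p)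
    -- the parameters of the density: `L` Fox H-functions of common order
    (P : Fin L → FoxParams p q) (hPm : ∀ l, (P l).m = m) (hPn : ∀ l, (P l).n = n)
    (hA : ∀ l i, 0 < (P l).A i) (hB : ∀ l i, 0 < (P l).B i)
    (ψ φ : Fin L → ℝ) (hψ : ∀ l, 0 < ψ l) (hφ : ∀ l, 0 < φ l)
    (σ : Fin L → ℝ) (hσ : ∀ l, (P l).IsContour (σ l))
    -- the ideal SNR, with probability density `f`
    (γid : Ω → ℝ) (hγ : AEMeasurable γid μ) (f : ℝ → ℝ) (hf0 : ∀ x, 0 < x → 0 ≤ f x)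
    (hf : ∀ x, 0 < x → (f x : ℂ) = ∑ l, (ψ l : ℂ) * (P l).foxH (σ l) (φ l * x))
    (hlaw : μ.map γid =
      (volume.restrict (Set.Ioi (0 : ℝ))).withDensity fun x => ENNReal.ofReal (f x))
    -- the impairment parameters
    (ω ϱ τ : ℝ) (hω : 0 < ω) (hϱ : 0 < ϱ) (hτ : 0 < τ)
    -- the contours `Re v = c l`, `Re w = d l` of the bivariate H-functions
    (c d : Fin L → ℝ) (hc : ∀ l, (P l).ccdf.IsContour (c l))
    (hcd : ∀ l, (capacityParams (P l)).Separates (c l) (d l)) :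
    -- the integral that defines the capacity makes sense,
    (∀ x ∈ Set.Ioo 0 (ω / ϱ),
      DifferentiableAt ℝ (distribFun μ fun o => sinr ω ϱ τ (γid o)) x) ∧
    IntervalIntegrable
      (fun x => Real.log (1 + x) * deriv (distribFun μ fun o => sinr ω ϱ τ (γid o)) x)
      volume 0 (ω / ϱ) ∧
    -- so do the bivariate H-functions,
    (∀ l, Integrable
      ((capacityParams (P l)).integrand (c l) (d l) (φ l * τ / ϱ) (ω / ϱ))) ∧
    -- and the capacity has the closed form
    ((oraCapacity (distribFun μ fun o => sinr ω ϱ τ (γid o)) (ω / ϱ) : ℝ) : ℂ) =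
      1 / (Real.log 2 : ℂ) * ∑ l, (ψ l : ℂ) / (φ l : ℂ) *
        (capacityParams (P l)).foxH (c l) (d l) (φ l * τ / ϱ) (ω / ϱ) := by
  have hPn' : ∀ l, (P l).n ≤ p := fun l => (hPn l).le.trans hn
  have hfc := continuousOn_of_eq_sum_foxH hφ hσ hf
  have hr : 0 < ω / ϱ := by positivity
  have hX : ∀ l, 0 < φ l * τ / ϱ := fun l => by have := hφ l; positivity
  obtain ⟨hint, hval⟩ := integral_log_mul_deriv_distribFun_sinr hω hϱ hτ hγ hf0 hfc hlaw
  refine ⟨fun x hx => (hasDerivAt_distribFun_sinr hϱ hτ hγ hf0 hfc hlaw hx).differentiableAt, hint,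
    fun l => integrable_capacityParams_integrand (hPn' l) (hc l) (hcd l) (hX l) hr, ?_⟩
  have hccdf : ∀ x ∈ Set.Ioo 0 (ω / ϱ),
      (((1 - distribFun μ γid (τ / ϱ * (x / (ω / ϱ - x)))) / (1 + x) : ℝ) : ℂ) =
        ∑ l, (ψ l : ℂ) / (φ l : ℂ) *
          ((P l).ccdf.foxH (c l) (φ l * τ / ϱ * (x / (ω / ϱ - x))) / (1 + x : ℂ)) := by
    intro x hx
    have hy : 0 < τ / ϱ * (x / (ω / ϱ - x)) :=
      mul_pos (by positivity) (div_pos hx.1 (by linarith [hx.2]))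
    rw [Complex.ofReal_div, one_sub_distribFun_eq_sum_foxH hPn' hφ hσ hc hf hγ hf0 hlaw hy,
      Finset.sum_div]
    refine Finset.sum_congr rfl fun l _ => ?_
    rw [mul_div_assoc, show φ l * (τ / ϱ * (x / (ω / ϱ - x))) =
      φ l * τ / ϱ * (x / (ω / ϱ - x)) by ring]
    push_cast
    rfl
  have hfox := fun l => integrable_and_integral_ccdf_foxH_div (hPn' l) (hc l) (hcd l) (hX l) hr
  rw [oraCapacity, hval, Complex.ofReal_mul, ← intervalIntegral.integral_ofReal]
  congr 1
  · push_cast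
    rfl
  · simp only [← (hfox _).2, ← intervalIntegral.integral_const_mul]
    -- Passing to the open interval discards x = 0 and x = ω/ϱ, where the tail formula is not
    -- available.
    rw [← intervalIntegral.integral_finsetSum fun l _ => (hfox l).1.const_mul _,
      intervalIntegral.integral_of_le hr.le, intervalIntegral.integral_of_le hr.le,
      integral_Ioc_eq_integral_Ioo, integral_Ioc_eq_integral_Ioo]
    exact setIntegral_congr_fun measurableSet_Ioo hccdf
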